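/- Let $p$ be a prime and let $(A,\mathfrak m)\to(R,\mathfrak n)$ be a flat local homomorphism (automatically injective) of Noetherian normal local domains of characteristic $p$ such that $R/\mathfrak mR$ is a regular local ring; write $f:\operatorname{Spec}R\to\operatorname{Spec}A$ for the induced map. Let $D=\sum_P n_P P$ be an effective Weil divisor on $\operatorname{Spec}A$, where $P$ ranges over the height one primes of $A$, and let $e>0$ be an integer. Let $A(D)=\{g\in\operatorname{Frac}(A)\mid g=0\text{ or }\operatorname{div}(g)+D\ge 0\}$, let $F^e_*A(D)$ be the abelian group $A(D)$ on which $a\in A$ acts as multiplication by $a^{p^e}$, and let $$I_e(A,D)=\bigl\langle a\in A \;\bigm|\; A\to F^e_*A(D),\ 1\mapsto F^e_*a,\ \text{is not a pure map of $A$-modules}\bigr\rangle ,$$ where a map $M\to N$ of $A$-modules is pure if $M\otimes_AQ\to N\otimes_AQ$ is injective for every $A$-module $Q$. Let $f^*D$ be the flat pullback of $D$, that is, the effective Weil divisor on $\operatorname{Spec}R$ whose coefficient at a height one prime $\mathfrak q$ of $R$ is $n_P\cdot\ell_{R_{\mathfrak q}}(R_{\mathfrak q}/PR_{\mathfrak q})$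 if $P=\mathfrak q\cap A$ has height one, and $0$ otherwise; define $I_e(R,f^*D)$ in the same way over $R$. Then $A/I_e(A,D)$ has finite length and $$\ell_R\bigl(R/I_e(R,f^*D)\bigr)=p^{e(\dim R-\dim A)}\cdot\ell_A\bigl(A/I_e(A,D)\bigr),$$ where $\dim R-\dim A$ is a non-negative integer. More precisely, if $\delta=\dim R/\mathfrak mR$ and $x_1,\dots,x_\delta\in R$ are elements whose images in $R/\mathfrak mR$ form a regular system of parameters (generate its maximal ideal), then $$I_e(R,f^*D)=I_e(A,D)R+\bigl(x_1^{p^e},\dots,x_\delta^{p^e}\bigr).$$ -/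

import Mathlib

open IsLocalRing

noncomputable section

universe u v

/-- An `A`-linear map `f : M → N` is pure if `f ⊗ Q : M ⊗ Q → N ⊗ Q` is injective for every
`A`-module `Q`. (Every module is the filtered union of its finitely generated submodules, so it is
enough to let `Q` range over the modules in the universe of `A`.) -/
def IsPureMap {A : Type u} [CommRing A] {M N : Type*} [AddCommGroup M] [Module A M]
    [AddCommGroup N] [Module A N] (f : M →ₗ[A] N) : Prop :=
  ∀ (Q : Type u) [AddCommGroup Q] [Module A Q], Function.Injective (f.rTensor Q)

/-- The Frobenius pushforward `F^e_* M` of an `A`-module `M`, also written `M^{1/p^e}`: the abelian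
group `M` on which `a` acts as `a ^ p ^ e`. -/
def FrobeniusPushforward (A : Type*) (_p _e : ℕ) (M : Type*) [CommRing A] [AddCommGroup M]
    [Module A M] : Type _ := M

namespace FrobeniusPushforward

variable (A : Type*) (p e : ℕ) (M : Type*) [CommRing A] [AddCommGroup M] [Module A M]

instance : AddCommGroup (FrobeniusPushforward A p e M) := inferInstanceAs (AddCommGroup M)

instance [ExpChar A p] : Module A (FrobeniusPushforward A p e M) :=
  Module.compHom M (iterateFrobenius A p e)

/-- The element `F^e_* m` of `F^e_* M`. -/
def of (m : M) : FrobeniusPushforward A p e M := m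

theorem smul_of [ExpChar A p] (a : A) (m : M) :
    a • of A p e M m = of A p e M (a ^ p ^ e • m) := rfl

end FrobeniusPushforward

/-- The height one primes of `A`, that is, the prime divisors on `Spec A`. -/
abbrev HeightOnePrime (A : Type*) [CommRing A] : Type _ :=
  {P : PrimeSpectrum A // P.asIdeal.height = 1}

/-- Weil divisors on `Spec A`; a divisor `D` is effective if `0 ≤ D`. -/
abbrev WeilDivisor (A : Type*) [CommRing A] : Type _ := HeightOnePrime A →₀ ℤ

namespace HeightOnePrime

/-- The local ring `A_P`. -/
abbrev localRing {A : Type*} [CommRing A] (P : HeightOnePrime A) : Type _ :=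
  Localization.AtPrime P.1.asIdeal

instance {A : Type*} [CommRing A] [IsDomain A] [IsNoetherianRing A] [IsIntegrallyClosed A]
    (P : HeightOnePrime A) : IsDiscreteValuationRing P.localRing := by
  have hic : IsIntegrallyClosed P.localRing :=
    isIntegrallyClosed_of_isLocalization P.localRing P.1.asIdeal.primeCompl
      P.1.asIdeal.primeCompl_le_nonZeroDivisors
  have hdim : ringKrullDim P.localRing = 1 := by
    rw [IsLocalization.AtPrime.ringKrullDim_eq_height P.1.asIdeal P.localRing, P.2]; rfl
  have hht : (maximalIdeal P.localRing).height = 1 := by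
    have h := IsLocalRing.maximalIdeal_height_eq_ringKrullDim (R := P.localRing)
    rw [hdim] at h
    exact_mod_cast h
  have hfield : ¬ IsField P.localRing := fun h =>
    Ideal.ne_bot_of_height_eq_one hht ((isField_iff_maximalIdeal_eq).1 h)
  have : (maximalIdeal P.localRing).FiniteHeight := by
    simp [Ideal.finiteHeight_iff, hht]
  have huniq : ∃! I : Ideal P.localRing, I ≠ ⊥ ∧ I.IsPrime := by
    refine ⟨maximalIdeal P.localRing, ⟨Ideal.ne_bot_of_height_eq_one hht, inferInstance⟩, ?_⟩
    rintro I ⟨hI, hI'⟩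
    refine Ideal.eq_of_le_of_height_le _ (le_maximalIdeal hI'.ne_top) ?_
    rw [hht, Order.one_le_iff_ne_zero]
    exact fun h => hI (Ideal.height_eq_zero_iff_eq_bot.1 h)
  have h : IsDiscreteValuationRing P.localRing ↔
      IsIntegrallyClosed P.localRing ∧ ∃! I : Ideal P.localRing, I ≠ ⊥ ∧ I.IsPrime :=
    (IsDiscreteValuationRing.TFAE P.localRing hfield).out 0 3
  exact h.2 ⟨hic, huniq⟩

/-- The discrete valuation of the fraction field of `A` attached to the height one prime `P`,
written multiplicatively: if `f ≠ 0` vanishes to order `n` along `P`, then its value is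
`exp (-n)`. -/
def valuation {A : Type*} [CommRing A] [IsDomain A] [IsNoetherianRing A] [IsIntegrallyClosed A]
    (P : HeightOnePrime A) : Valuation (FractionRing A) (WithZero (Multiplicative ℤ)) :=
  (IsDiscreteValuationRing.maximalIdeal P.localRing).valuation (FractionRing A)

theorem valuation_algebraMap_le_one {A : Type*} [CommRing A] [IsDomain A] [IsNoetherianRing A]
    [IsIntegrallyClosed A] (P : HeightOnePrime A) (a : A) :
    P.valuation (algebraMap A (FractionRing A) a) ≤ 1 := by
  rw [IsScalarTower.algebraMap_apply A P.localRing (FractionRing A)]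
  exact IsDedekindDomain.HeightOneSpectrum.valuation_le_one _ _

end HeightOnePrime

namespace WeilDivisor

section Module

variable {A : Type*} [CommRing A] [IsDomain A] [IsNoetherianRing A] [IsIntegrallyClosed A]

/-- The module `A(D)` of those `f` in the fraction field with `f = 0` or `div f + D ≥ 0`. -/
def sections (D : WeilDivisor A) : Submodule A (FractionRing A) where
  carrier := {f | ∀ P : HeightOnePrime A, P.valuation f ≤ WithZero.exp (D P)}
  zero_mem' P := by simp
  add_mem' hf hg P := Valuation.map_add_le _ (hf P) (hg P)
  smul_mem' a f hf P := by
    rw [Algebra.smul_def, map_mul]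
    exact (mul_le_of_le_one_left' (P.valuation_algebraMap_le_one a)).trans (hf P)

theorem algebraMap_mem_sections {D : WeilDivisor A} (hD : 0 ≤ D) (a : A) :
    algebraMap A (FractionRing A) a ∈ D.sections := fun P =>
  (P.valuation_algebraMap_le_one a).trans <| by
    rw [← WithZero.exp_zero, WithZero.exp_le_exp]
    exact hD P

/-- For an effective divisor `D`, the `A`-linear map `A → F^e_* A(D)` with `1 ↦ F^e_* a`. -/
def frobeniusMap (D : WeilDivisor A) (p e : ℕ) [ExpChar A p] (hD : 0 ≤ D) (a : A) :
    A →ₗ[A] FrobeniusPushforward A p e D.sections :=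
  LinearMap.toSpanSingleton A _
    (FrobeniusPushforward.of A p e D.sections
      ⟨algebraMap A (FractionRing A) a, algebraMap_mem_sections hD a⟩)

/-- The `e`-th Frobenius degeneracy ideal `I_e(A, D)` along the effective divisor `D`. -/
def degeneracyIdeal (D : WeilDivisor A) (p e : ℕ) [ExpChar A p] (hD : 0 ≤ D) : Ideal A :=
  Ideal.span {a : A | ¬ IsPureMap (D.frobeniusMap p e hD a)}

end Module

section Pullback

variable {A : Type u} (R : Type v) [CommRing A] [CommRing R] [Algebra A R]

open Classical in
/-- The coefficient at `Q` of the flat pullback of `D` to `Spec R`: if `P = Q ∩ A` has height one,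
it is the coefficient of `D` at `P` times the length of the local ring `R_Q / P R_Q` at `Q` of the
preimage of the prime divisor `P`; otherwise `Q` lies over no prime divisor and it is zero. -/
def pullbackCoeff (D : WeilDivisor A) (Q : HeightOnePrime R) : ℤ :=
  if h : (Q.1.asIdeal.under A).height = 1 then
    D ⟨⟨Q.1.asIdeal.under A, inferInstance⟩, h⟩ *
      (Module.length Q.localRing
        (Q.localRing ⧸ (Q.1.asIdeal.under A).map (algebraMap A Q.localRing))).toNat
  else 0

theorem finite_support_pullbackCoeff [IsDomain A] [IsDomain R] [IsNoetherianRing R]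
    [Module.Flat A R] (D : WeilDivisor A) : (Function.support (D.pullbackCoeff R)).Finite := by
  have hinj : Function.Injective (algebraMap A R) := FaithfulSMul.algebraMap_injective A R
  have hfin : (⋃ P ∈ D.support,
      (P.1.asIdeal.map (algebraMap A R)).minimalPrimes).Finite :=
    D.support.finite_toSet.biUnion fun P _ =>
      Ideal.finite_minimalPrimes_of_isNoetherianRing R _
  refine Set.Finite.of_finite_image (f := fun Q => Q.1.asIdeal) (hfin.subset ?_) ?_
  · rintro _ ⟨Q, hQ, rfl⟩
    rw [Function.mem_support, pullbackCoeff] at hQ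
    split_ifs at hQ with h
    · refine Set.mem_biUnion (x := ⟨⟨Q.1.asIdeal.under A, inferInstance⟩, h⟩)
        (Finsupp.mem_support_iff.2 (left_ne_zero_of_mul hQ)) ?_
      have : Q.1.asIdeal.FiniteHeight := by simp [Ideal.finiteHeight_iff, Q.2]
      refine Ideal.mem_minimalPrimes_of_height_le Ideal.map_comap_le ?_
      rw [Q.2, Order.one_le_iff_ne_zero, Ne, Ideal.height_eq_zero_iff_eq_bot,
        Ideal.map_eq_bot_iff_of_injective hinj]
      exact Ideal.ne_bot_of_height_eq_one h
    · exact absurd rfl hQ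
  · exact fun Q _ Q' _ h => Subtype.ext (PrimeSpectrum.ext h)

/-- The pullback `f^* D` of a Weil divisor along a flat morphism `f : Spec R → Spec A`. -/
def pullback [IsDomain A] [IsDomain R] [IsNoetherianRing R] [Module.Flat A R]
    (D : WeilDivisor A) : WeilDivisor R :=
  Finsupp.ofSupportFinite (D.pullbackCoeff R) (D.finite_support_pullbackCoeff R)

theorem pullback_nonneg [IsDomain A] [IsDomain R] [IsNoetherianRing R] [Module.Flat A R]
    {D : WeilDivisor A} (hD : 0 ≤ D) : 0 ≤ D.pullback R := fun Q => by
  change 0 ≤ D.pullbackCoeff R Q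
  unfold pullbackCoeff
  split_ifs with h
  · exact mul_nonneg (hD _) (Int.natCast_nonneg _)
  · exact le_rfl

end Pullback

end WeilDivisor

end

/-! Purity of `A → N`, `1 ↦ n`, can be tested on finite length modules `Q` whose socle is simple,
generated by some `z`: the map fails to be pure exactly when `n ⊗ z = 0` for some such pair. These
pairs replace the injective hull of the residue field. Any two embed in a third with the socle
generators identified (`IsSocleGenerator.exists_amalgam`), so over a Noetherian ring one pair
computes the whole degeneracy ideal as the annihilator of `n ⊗ z`
(`exists_torsionOf_eq_impurityIdeal`).

Let `x` be a sequence in `R` that is a regular system of parameters of the closed fibre, `J_t = (x_i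
^ (t + 1))`, and let `Q` have simple socle generated by `z`. Each `R ⧸ J_t` is flat over `A`, and
`(R ⊗ Q) ⧸ J_t` has simple socle generated by `(∏ x_i) ^ t ⊗ z`. If `Q` is faithful over `A ⧸ 𝔪 ^ (t
+ 1)`, this module is faithful over `R ⧸ (𝔪 ^ (t + 1) R + J_t)`, and a length count shows that it
contains every test module over `R` killed by that ideal. So these modules suffice to test purity
over `R`.

Sections satisfy `R ⊗ A(D) ≅ R(f^*D)`: both sides are conductors `{z | z I ⊆ ring}` for `I = ∏ P ^
n_P`, and conductors commute with flat base change (`exists_baseChange_equiv`). Over `F^e_* R`,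
flatness then turns the vanishing of `b • n` against a test module into `b (∏ x_i) ^ (t p^e) ∈
I_e(A, D) R + (x_i ^ ((t + 1) p^e))`, up to replacing `I_e(A, D)` by a smaller annihilator. As the
`x_i` form a regular sequence modulo any ideal extended from `A`, the product cancels and leaves `b
∈ I_e(A, D) R + (x_i ^ p^e)` (`impurityIdeal_baseChange`).

For the lengths, replacing `x_i` by `x_i ^ p^e` in `R ⧸ I_e(A, D) R` multiplies the colength by
`p^e` for each `i`, and `R ⧸ (x)` is flat over `A` with closed fibre the residue field of `R`, so it
preserves lengths. -/

noncomputable section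

universe w

open TensorProduct

/-! ### Modules with simple socle -/

/-- `u` lies in every nonzero submodule of `Q`. For a module of finite length over a local ring
this says that `u` generates the socle and that the socle is simple. -/
def IsSocleGenerator (R : Type*) {Q : Type*} [CommRing R] [AddCommGroup Q] [Module R Q]
    (u : Q) : Prop :=
  u ≠ 0 ∧ ∀ z : Q, z ≠ 0 → ∃ r : R, r • z = u

theorem isFiniteLength_of_le_annihilator {R : Type*} [CommRing R] {J : Ideal R} {M : Type*}
    [AddCommGroup M] [Module R M]
    [Module.Finite R M] (hJ : J ≤ Module.annihilator R M) (hfin : IsFiniteLength R (R ⧸ J)) :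
    IsFiniteLength R M := by
  obtain ⟨n, f, hf⟩ := Module.Finite.exists_fin' R M
  have hn : IsFiniteLength R (Fin n → R ⧸ J) := by
    rw [isFiniteLength_iff_isNoetherian_isArtinian] at hfin ⊢
    have := hfin.1
    have := hfin.2
    exact ⟨inferInstance, inferInstance⟩
  let g : (Fin n → R ⧸ J) →ₗ[R] M := LinearMap.lsum R (fun _ => R ⧸ J) R fun i =>
    J.liftQ (LinearMap.toSpanSingleton R M (f (Pi.single i 1))) fun a ha => by
      simpa using Module.mem_annihilator.1 (hJ ha) _
  refine hn.of_surjective (f := g) fun y => ?_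
  obtain ⟨x, rfl⟩ := hf y
  refine ⟨fun i => J.mkQ (x i), ?_⟩
  rw [LinearMap.pi_apply_eq_sum_univ f x]
  simp only [g, LinearMap.lsum_apply, LinearMap.sum_apply, LinearMap.comp_apply,
    LinearMap.proj_apply, Submodule.liftQ_apply, Submodule.mkQ_apply,
    LinearMap.toSpanSingleton_apply]
  refine Finset.sum_congr rfl fun i _ => ?_
  congr 2
  ext j
  simp [Pi.single_apply, eq_comm]

namespace IsSocleGenerator

section Basic

variable {R : Type*} [CommRing R] {Q Q' : Type*} [AddCommGroup Q] [Module R Q]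
  [AddCommGroup Q'] [Module R Q'] {u : Q}

theorem mkQ_iff {K : Submodule R Q} :
    IsSocleGenerator R (K.mkQ u) ↔ u ∉ K ∧ ∀ z ∉ K, ∃ r : R, r • z - u ∈ K := by
  unfold IsSocleGenerator
  rw [Ne, Submodule.mkQ_apply, Submodule.Quotient.mk_eq_zero]
  refine and_congr_right fun _ => ⟨fun h z hz => ?_, fun h z hz => ?_⟩
  · obtain ⟨r, hr⟩ := h (K.mkQ z) (by simpa using hz)
    exact ⟨r, (Submodule.Quotient.eq K).1 hr⟩
  · obtain ⟨z, rfl⟩ := K.mkQ_surjective z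
    obtain ⟨r, hr⟩ := h z (by simpa using hz)
    exact ⟨r, (Submodule.Quotient.eq K).2 hr⟩

theorem map_equiv (h : IsSocleGenerator R u) (e : Q ≃ₗ[R] Q') : IsSocleGenerator R (e u) := by
  refine ⟨by simpa using h.1, fun z hz => ?_⟩
  obtain ⟨r, hr⟩ := h.2 (e.symm z) (by simpa using hz)
  exact ⟨r, by rw [← hr]; simp⟩

theorem injective_of_map_ne_zero (h : IsSocleGenerator R u) (f : Q →ₗ[R] Q') (hf : f u ≠ 0) :
    Function.Injective f := by
  rw [injective_iff_map_eq_zero]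
  intro z hz
  by_contra hne
  obtain ⟨r, hr⟩ := h.2 z hne
  exact hf (by rw [← hr, map_smul, hz, smul_zero])

variable [IsLocalRing R]

theorem smul_eq_zero (h : IsSocleGenerator R u) {a : R} (ha : a ∈ maximalIdeal R) :
    a • u = 0 := by
  by_contra hne
  obtain ⟨r, hr⟩ := h.2 _ hne
  have hun : IsUnit (1 - r * a) := by
    by_contra hnu
    exact (maximalIdeal R).ne_top_iff_one.1 (maximalIdeal.isMaximal R).ne_top
      (by simpa using add_mem ((mem_maximalIdeal _).2 hnu) (Ideal.mul_mem_left _ r ha))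
  refine h.1 (hun.smul_eq_zero.1 ?_)
  rw [sub_smul, one_smul, mul_smul, hr, sub_self]

/-- A nonzero `z` killed by the maximal ideal has a multiple `r • z = u ≠ 0`, which forces `r` to be
a unit. -/
theorem mem_span_of_smul_eq_zero (h : IsSocleGenerator R u) {z : Q}
    (hz : ∀ a ∈ maximalIdeal R, a • z = 0) : z ∈ Submodule.span R {u} := by
  by_cases hz0 : z = 0
  · simp [hz0]
  obtain ⟨r, hr⟩ := h.2 z hz0
  have hun : IsUnit r := by
    by_contra hnu
    exact h.1 (by rw [← hr, hz r ((mem_maximalIdeal _).2 hnu)])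
  obtain ⟨s, hs⟩ := hun.exists_left_inv
  exact Submodule.mem_span_singleton.2 ⟨s, by rw [← hr, smul_smul, hs, one_smul]⟩

theorem torsionOf_eq (h : IsSocleGenerator R u) : Ideal.torsionOf R Q u = maximalIdeal R := by
  refine le_antisymm (le_maximalIdeal fun htop => h.1 ?_) fun a ha =>
    (Ideal.mem_torsionOf_iff _ _).2 (h.smul_eq_zero ha)
  have : (1 : R) ∈ Ideal.torsionOf R Q u := htop ▸ Submodule.mem_top
  simpa using this

end Basic

section Exists

variable {R : Type*} [CommRing R]

/-- Take `K` maximal among the submodules that contain `L` and avoid `x`: every strictly larger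
submodule contains `x`. -/
theorem exists_mkQ {Q : Type*} [AddCommGroup Q] [Module R Q] [IsNoetherian R Q]
    (L : Submodule R Q) {x : Q} (hx : x ∉ L) :
    ∃ K : Submodule R Q, L ≤ K ∧ IsSocleGenerator R (K.mkQ x) := by
  obtain ⟨K, ⟨hLK, hxK⟩, hmax⟩ := set_has_maximal_iff_noetherian.2 ‹IsNoetherian R Q›
    {K : Submodule R Q | L ≤ K ∧ x ∉ K} ⟨L, le_rfl, hx⟩
  refine ⟨K, hLK, mkQ_iff.2 ⟨hxK, fun z hz => ?_⟩⟩
  have hlt : K < K ⊔ Submodule.span R {z} := by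
    refine lt_of_le_of_ne le_sup_left fun heq => hz ?_
    rw [heq]
    exact Submodule.mem_sup_right (Submodule.mem_span_singleton_self z)
  have hmem : x ∈ K ⊔ Submodule.span R {z} := by
    by_contra hne
    exact hmax _ ⟨hLK.trans le_sup_left, hne⟩ hlt
  obtain ⟨k, hk, y, hy, rfl⟩ := Submodule.mem_sup.1 hmem
  obtain ⟨r, rfl⟩ := Submodule.mem_span_singleton.1 hy
  exact ⟨r, by simpa using hk⟩

/-- Two modules with simple socle embed into a common one. -/
theorem exists_amalgam [IsNoetherianRing R] [IsLocalRing R] {Q₁ Q₂ : Type w}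
    [AddCommGroup Q₁] [Module R Q₁] [AddCommGroup Q₂] [Module R Q₂]
    [Module.Finite R Q₁] [Module.Finite R Q₂] {u₁ : Q₁} {u₂ : Q₂}
    (h₁ : IsSocleGenerator R u₁) (h₂ : IsSocleGenerator R u₂) :
    ∃ (Q : Type w) (_ : AddCommGroup Q) (_ : Module R Q) (_ : Module.Finite R Q)
      (i₁ : Q₁ →ₗ[R] Q) (i₂ : Q₂ →ₗ[R] Q), Function.Injective i₁ ∧ Function.Injective i₂ ∧
      i₁ u₁ = i₂ u₂ ∧ IsSocleGenerator R (i₁ u₁) ∧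
      Module.annihilator R Q₁ ⊓ Module.annihilator R Q₂ ≤ Module.annihilator R Q := by
  have hx : (u₁, (0 : Q₂)) ∉ Submodule.span R {(u₁, -u₂)} := by
    intro hmem
    obtain ⟨r, hr⟩ := Submodule.mem_span_singleton.1 hmem
    rw [Prod.smul_mk, Prod.mk.injEq, smul_neg, neg_eq_zero] at hr
    have hrm : r ∈ maximalIdeal R := by
      rw [← h₂.torsionOf_eq]; exact (Ideal.mem_torsionOf_iff _ _).2 hr.2
    exact h₁.1 (by rw [← hr.1, h₁.smul_eq_zero hrm])
  -- Gluing along `u₁ = u₂` alone may leave submodules that miss the common element. Enlarging the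
  -- kernel until it is maximal without `(u₁, 0)` removes them, and both factors still embed because
  -- their socle generators survive.
  obtain ⟨K, hLK, hK⟩ := exists_mkQ _ hx
  have hmem : (u₁, -u₂) ∈ K := hLK (Submodule.mem_span_singleton_self _)
  have heq : (K.mkQ ∘ₗ LinearMap.inl R Q₁ Q₂) u₁ = (K.mkQ ∘ₗ LinearMap.inr R Q₁ Q₂) u₂ :=
    (Submodule.Quotient.eq K).2 (by simpa using hmem)
  refine ⟨(Q₁ × Q₂) ⧸ K, inferInstance, inferInstance, inferInstance,
    K.mkQ ∘ₗ LinearMap.inl R Q₁ Q₂, K.mkQ ∘ₗ LinearMap.inr R Q₁ Q₂,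
    h₁.injective_of_map_ne_zero _ hK.1, h₂.injective_of_map_ne_zero _ (heq ▸ hK.1), heq, hK, ?_⟩
  rintro a ⟨ha₁, ha₂⟩
  rw [Module.mem_annihilator]
  intro z
  obtain ⟨⟨z₁, z₂⟩, rfl⟩ := K.mkQ_surjective z
  rw [← map_smul, Prod.smul_mk, Module.mem_annihilator.1 ha₁, Module.mem_annihilator.1 ha₂]
  exact map_zero _

end Exists

section Length

variable {R : Type*} [CommRing R] [IsLocalRing R] {Q : Type*} [AddCommGroup Q] [Module R Q] {u : Q}

theorem length_span_le (h : IsSocleGenerator R u) :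
    Module.length R (Submodule.span R {u}) ≤ 1 := by
  have hs : IsSimpleModule R (R ⧸ maximalIdeal R) :=
    isSimpleModule_iff_quot_maximal.2 ⟨_, maximalIdeal.isMaximal R, ⟨LinearEquiv.refl _ _⟩⟩
  rw [← Module.length_eq_one R (R ⧸ maximalIdeal R)]
  have e := Ideal.quotTorsionOfEquivSpanSingleton R Q u
  rw [h.torsionOf_eq] at e
  exact e.length_eq.ge

/-- Half of Matlis duality, with no injectivity of `Q`: along a composition series of `M`, each
simple factor contributes at most the homomorphisms from the residue field to `Q`, which land in the
line spanned by `u`. -/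
theorem length_hom_le (h : IsSocleGenerator R u) {M : Type*} [AddCommGroup M] [Module R M]
    (hM : IsFiniteLength R M) : Module.length R (M →ₗ[R] Q) ≤ Module.length R M := by
  induction hM with
  | of_subsingleton =>
    rw [Module.length_eq_zero_iff.2 ⟨fun f g => LinearMap.ext fun x => by
      rw [Subsingleton.elim x 0, map_zero, map_zero]⟩]
    exact zero_le
  | @of_simple_quotient M _ _ N hS hN ih =>
    rw [Module.length_eq_add_of_exact N.subtype N.mkQ N.injective_subtype N.mkQ_surjective
      (LinearMap.exact_subtype_mkQ N)]
    -- Restriction of homomorphisms to `N` need not be surjective, so it is cut down to its range.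
    -- Only an inequality of lengths results.
    have hex : Function.Exact (LinearMap.lcomp R Q N.mkQ)
        (LinearMap.rangeRestrict (LinearMap.lcomp R Q N.subtype)) := by
      intro f
      rw [← Subtype.coe_inj]
      change (LinearMap.lcomp R Q N.subtype) f = 0 ↔ _
      constructor
      · intro hf
        refine ⟨N.liftQ f fun x hx => ?_, LinearMap.ext fun x => rfl⟩
        exact LinearMap.congr_fun hf ⟨x, hx⟩
      · rintro ⟨g, rfl⟩
        ext x
        change g (N.mkQ x) = 0
        rw [Submodule.mkQ_apply, (Submodule.Quotient.mk_eq_zero N).2 x.2, map_zero]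
    rw [Module.length_eq_add_of_exact _ _
      (fun f g hfg => LinearMap.cancel_right N.mkQ_surjective |>.1 hfg)
      (LinearMap.surjective_rangeRestrict _) hex, add_comm]
    refine add_le_add ((Module.length_le_of_injective _ (Submodule.injective_subtype _)).trans ih) ?_
    rw [Module.length_eq_one R (M ⧸ N)]
    refine le_trans ?_ h.length_span_le
    obtain ⟨I, hI, ⟨e⟩⟩ := isSimpleModule_iff_quot_maximal.1 hS
    obtain rfl := eq_maximalIdeal hI
    let s : M ⧸ N := e.symm (Ideal.Quotient.mk _ 1)
    have hs : ∀ a ∈ maximalIdeal R, a • s = 0 := by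
      intro a ha
      rw [← map_smul, ← Ideal.Quotient.mk_eq_mk, ← Submodule.Quotient.mk_smul,
        (Submodule.Quotient.mk_eq_zero _).2 (by simpa using ha), map_zero]
    have hgen : ∀ z : M ⧸ N, ∃ r : R, r • s = z := by
      intro z
      obtain ⟨r, hr⟩ := Ideal.Quotient.mk_surjective (e z)
      refine ⟨r, e.injective ?_⟩
      rw [map_smul, e.apply_symm_apply, ← hr, ← Ideal.Quotient.mk_eq_mk,
        ← Submodule.Quotient.mk_smul, smul_eq_mul, mul_one]
      rfl
    let ev : (M ⧸ N →ₗ[R] Q) →ₗ[R] Submodule.span R {u} :=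
      (LinearMap.applyₗ s).codRestrict _ fun f => h.mem_span_of_smul_eq_zero fun a ha => by
        rw [LinearMap.applyₗ_apply_apply, ← map_smul, hs a ha, map_zero]
    refine Module.length_le_of_injective ev fun f g hfg => LinearMap.ext fun z => ?_
    obtain ⟨r, rfl⟩ := hgen z
    rw [map_smul, map_smul]
    exact congrArg (r • ·) (congrArg Subtype.val hfg)

/-- `Q` embeds in `Hom(R ⧸ J, Q)` through `z ↦ (a ↦ a • z)`, since `J` kills `Q`. -/
theorem length_le [Module.Finite R Q] (h : IsSocleGenerator R u) {J : Ideal R}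
    (hJ : J ≤ Module.annihilator R Q) (hfin : IsFiniteLength R (R ⧸ J)) :
    Module.length R Q ≤ Module.length R (R ⧸ J) := by
  refine le_trans (Module.length_le_of_injective (N := Q) (M := R ⧸ J →ₗ[R] Q)
    { toFun := fun z => J.liftQ (LinearMap.toSpanSingleton R Q z) fun a ha => ?_
      map_add' := fun x y => ?_
      map_smul' := fun r x => ?_ } fun x y hxy => ?_) (h.length_hom_le hfin)
  · simpa using Module.mem_annihilator.1 (hJ ha) z
  · refine LinearMap.ext fun t => ?_
    obtain ⟨t, rfl⟩ := J.mkQ_surjective t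
    exact smul_add t x y
  · refine LinearMap.ext fun t => ?_
    obtain ⟨t, rfl⟩ := J.mkQ_surjective t
    exact smul_comm t r x
  · have h1 : (1 : R) • x = (1 : R) • y := LinearMap.congr_fun hxy (J.mkQ 1)
    rwa [one_smul, one_smul] at h1

/-- A module with simple socle that is faithful over the Artinian quotient `R ⧸ J` contains every
module with simple socle killed by `J`. -/
theorem exists_embedding [IsNoetherianRing R] {Q Q' : Type w} [AddCommGroup Q] [Module R Q]
    [AddCommGroup Q'] [Module R Q'] [Module.Finite R Q] [Module.Finite R Q'] {u : Q} {u' : Q'}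
    (h : IsSocleGenerator R u) (h' : IsSocleGenerator R u') {J : Ideal R}
    (hJ : Module.annihilator R Q = J) (hJ' : J ≤ Module.annihilator R Q')
    (hfin : IsFiniteLength R (R ⧸ J)) :
    ∃ i : Q' →ₗ[R] Q, i u' = u := by
  obtain ⟨P, _, _, _, i, i', hi, hi', heq, hP, hann⟩ := exists_amalgam h h'
  have hPle : Module.length R P ≤ Module.length R (R ⧸ J) :=
    hP.length_le ((le_inf hJ.ge hJ').trans hann) hfin
  have hQfl : IsFiniteLength R Q := isFiniteLength_of_le_annihilator hJ.ge hfin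
  have hPfl : IsFiniteLength R P :=
    isFiniteLength_of_le_annihilator ((le_inf hJ.ge hJ').trans hann) hfin
  -- Faithfulness embeds `R ⧸ J` in `End(Q)`, whose length is at most that of `Q`.
  have hQge : Module.length R (R ⧸ J) ≤ Module.length R Q := by
    refine le_trans ?_ (h.length_hom_le hQfl)
    let φ : R →ₗ[R] (Q →ₗ[R] Q) := LinearMap.lsmul R Q
    have hker : LinearMap.ker φ = J := by
      ext a
      rw [← hJ, LinearMap.mem_ker, Module.mem_annihilator]
      exact ⟨fun hh z => LinearMap.congr_fun hh z, fun hh => LinearMap.ext hh⟩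
    subst hker
    exact Module.length_le_of_injective ((LinearMap.ker φ).liftQ φ le_rfl)
      (LinearMap.ker_eq_bot.1 (Submodule.ker_liftQ_eq_bot _ _ _ le_rfl))
  -- The amalgam `P` is no longer than `R ⧸ J`, hence no longer than `Q`, so the embedding of `Q` in
  -- `P` is onto and the embedding of `Q'` in `P` can be read as one in `Q`.
  have hsurj : Function.Surjective i := by
    rw [← LinearMap.range_eq_top]
    by_contra hne
    rw [isFiniteLength_iff_isNoetherian_isArtinian] at hPfl
    have := hPfl.1
    have := hPfl.2
    have hlt := Submodule.length_lt hne
    rw [← (LinearEquiv.ofInjective i hi).length_eq] at hlt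
    exact absurd (hPle.trans hQge) (not_le.2 hlt)
  let e := LinearEquiv.ofBijective i ⟨hi, hsurj⟩
  exact ⟨e.symm.toLinearMap ∘ₗ i', e.injective ((e.apply_symm_apply _).trans heq.symm)⟩

/-- The Artinian quotients of a Noetherian local ring have a faithful module with simple socle. -/
theorem exists_annihilator_eq {R : Type u} [CommRing R] [IsLocalRing R] [IsNoetherianRing R]
    (J : Ideal R) (hJ : J ≤ maximalIdeal R) (hfin : IsFiniteLength R (R ⧸ J)) :
    ∃ (Q : Type u) (_ : AddCommGroup Q) (_ : Module R Q) (_ : Module.Finite R Q) (u : Q),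
      IsSocleGenerator R u ∧ Module.annihilator R Q = J := by
  have hart := (isFiniteLength_iff_isNoetherian_isArtinian.1 hfin).2
  have hcyc : ∀ b : R, b ∉ J → ∃ K : Ideal R, J ≤ K ∧ IsSocleGenerator R (K.mkQ b) :=
    fun b hb => exists_mkQ J hb
  -- The annihilators of the candidate modules, seen in the Artinian quotient `R ⧸ J`, where a
  -- minimal one exists.
  let 𝒮 : Set (Submodule R (R ⧸ J)) := {L | ∃ (Q : Type u) (_ : AddCommGroup Q) (_ : Module R Q)
    (_ : Module.Finite R Q) (u : Q), IsSocleGenerator R u ∧ J ≤ Module.annihilator R Q ∧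
      Submodule.comap J.mkQ L = Module.annihilator R Q}
  have hcomap : ∀ I : Ideal R, J ≤ I → Submodule.comap J.mkQ (Submodule.map J.mkQ I) = I :=
    fun I hI => by rw [Submodule.comap_map_eq, Submodule.ker_mkQ, sup_eq_left.2 hI]
  have hann : ∀ K : Ideal R, J ≤ K → J ≤ Module.annihilator R (R ⧸ K) := fun K hK => by
    rwa [Ideal.annihilator_quotient]
  have hne : 𝒮.Nonempty := by
    obtain ⟨K, hK, hu⟩ := hcyc 1 fun h =>
      (maximalIdeal R).ne_top_iff_one.1 (maximalIdeal.isMaximal R).ne_top (hJ h)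
    exact ⟨_, R ⧸ K, inferInstance, inferInstance, inferInstance, _, hu, hann K hK,
      hcomap _ (hann K hK)⟩
  obtain ⟨L, ⟨Q, _, _, _, u, hu, hJQ, hL⟩, hmin⟩ := WellFounded.has_min
    (wellFounded_lt (α := Submodule R (R ⧸ J))) 𝒮 hne
  refine ⟨Q, _, _, ‹_›, u, hu, le_antisymm (fun b hb => ?_) hJQ⟩
  by_contra hbJ
  -- If `b ∉ J` kills the minimal candidate, amalgamating it with a cyclic module whose socle is
  -- generated by the class of `b` gives a candidate not killed by `b`, hence with strictly smaller
  -- annihilator.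
  obtain ⟨K, hK, hu'⟩ := hcyc b hbJ
  obtain ⟨P, _, _, _, i, i', hi, hi', -, hP, hannP⟩ := exists_amalgam hu hu'
  have hJP := (le_inf hJQ (hann K hK)).trans hannP
  have hPQ : Module.annihilator R P ≤ Module.annihilator R Q :=
    LinearMap.annihilator_le_of_injective i hi
  refine hmin (Submodule.map J.mkQ (Module.annihilator R P))
    ⟨P, _, _, ‹_›, _, hP, hJP, hcomap _ hJP⟩ ?_
  refine lt_of_le_of_ne ?_ fun heq => ?_
  · rw [Submodule.map_le_iff_le_comap, hL]
    exact hPQ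
  · have : b ∈ Module.annihilator R P := by
      rw [← hcomap _ hJP, heq, hL]
      exact hb
    have hbK := LinearMap.annihilator_le_of_injective i' hi' this
    rw [Ideal.annihilator_quotient] at hbK
    exact hu'.1 ((Submodule.Quotient.mk_eq_zero _).2 hbK)

end Length

end IsSocleGenerator

/-! ### Testing purity on modules of finite length -/

section Purity

variable {R : Type u} [CommRing R] {N : Type*} [AddCommGroup N] [Module R N]

/-- Provides a copy of a finite module in the universe of `R`, where purity is tested. -/
theorem exists_quotient_fin_equiv {Q : Type*} [AddCommGroup Q] [Module R Q] [Module.Finite R Q] :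
    ∃ (k : ℕ) (K : Submodule R (Fin k → R)), Nonempty (Q ≃ₗ[R] (Fin k → R) ⧸ K) := by
  obtain ⟨k, f, hf⟩ := Module.Finite.exists_fin' R Q
  exact ⟨k, LinearMap.ker f, ⟨(f.quotKerEquivOfSurjective hf).symm⟩⟩

theorem not_isPureMap_of_tmul_eq_zero {n : N} {Q : Type*} [AddCommGroup Q] [Module R Q]
    [Module.Finite R Q] {z : Q} (hz : z ≠ 0) (h : n ⊗ₜ[R] z = 0) :
    ¬ IsPureMap (LinearMap.toSpanSingleton R N n) := by
  intro hp
  obtain ⟨k, K, ⟨e⟩⟩ := exists_quotient_fin_equiv (R := R) (Q := Q)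
  have hinj := hp ((Fin k → R) ⧸ K)
  have h0 : (1 : R) ⊗ₜ[R] e z = 0 := by
    refine hinj ?_
    rw [map_zero, LinearMap.rTensor_tmul, LinearMap.toSpanSingleton_apply, one_smul,
      ← e.coe_toLinearMap, ← LinearMap.lTensor_tmul, h, map_zero]
  have := congrArg (TensorProduct.lid R _) h0
  rw [TensorProduct.lid_tmul, one_smul, map_zero] at this
  exact hz (by simpa using this)

/-- An element of the kernel has the form `1 ⊗ z`. The vanishing of `n ⊗ z` already holds over a
finitely generated submodule; there Krull's intersection theorem puts `z` outside some `𝔪 ^ j Q₀`,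
and a quotient by a submodule maximal without `z` makes `z` the socle generator. The vanishing
persists in quotients. -/
theorem exists_of_not_isPureMap [IsNoetherianRing R] [IsLocalRing R] {n : N}
    (h : ¬ IsPureMap (LinearMap.toSpanSingleton R N n)) :
    ∃ (Q : Type u) (_ : AddCommGroup Q) (_ : Module R Q) (_ : Module.Finite R Q) (z : Q) (j : ℕ),
      IsSocleGenerator R z ∧ maximalIdeal R ^ j ≤ Module.annihilator R Q ∧ n ⊗ₜ[R] z = 0 := by
  unfold IsPureMap at h
  push Not at h
  obtain ⟨Q, _, _, hQ⟩ := h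
  rw [injective_iff_map_eq_zero] at hQ
  push Not at hQ
  obtain ⟨t, ht, htne⟩ := hQ
  obtain ⟨z, rfl⟩ := (TensorProduct.lid R Q).symm.surjective t
  rw [TensorProduct.lid_symm_apply] at ht htne
  rw [LinearMap.rTensor_tmul, LinearMap.toSpanSingleton_apply, one_smul] at ht
  have hz : z ≠ 0 := fun h0 => htne (by rw [h0, tmul_zero])
  -- descend the vanishing to a finitely generated submodule
  obtain ⟨Q₀, hQ₀, hz₀, h₀⟩ : ∃ (Q₀ : Submodule R Q) (_ : Q₀.FG) (hz₀ : z ∈ Q₀),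
      n ⊗ₜ[R] (⟨z, hz₀⟩ : Q₀) = 0 := by
    let P₁ : Submodule R Q := Submodule.span R {z}
    have h₁ : (⟨z, Submodule.mem_span_singleton_self z⟩ : P₁) ⊗ₜ[R] n ∈
        LinearMap.ker (P₁.subtype.rTensor N) := by
      simpa using congrArg (TensorProduct.comm R N Q) ht
    obtain ⟨Q₀, hle, hfg, h₀⟩ := TensorProduct.eq_zero_of_fg_of_subtype_eq_zero
      (Submodule.fg_span_singleton z) h₁
    refine ⟨Q₀, hfg, hle (Submodule.mem_span_singleton_self z), ?_⟩
    have := congrArg (TensorProduct.comm R Q₀ N) h₀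
    rwa [map_zero, LinearMap.rTensor_tmul, TensorProduct.comm_tmul] at this
  have : Module.Finite R Q₀ := Module.Finite.iff_fg.2 hQ₀
  have hne : (⟨z, hz₀⟩ : Q₀) ≠ 0 := fun h0 => hz (congrArg Subtype.val h0)
  obtain ⟨j, hj⟩ : ∃ j : ℕ, (⟨z, hz₀⟩ : Q₀) ∉ (maximalIdeal R ^ j • ⊤ : Submodule R Q₀) := by
    by_contra hall
    push Not at hall
    have : (⟨z, hz₀⟩ : Q₀) ∈ (⨅ i : ℕ, maximalIdeal R ^ i • ⊤ : Submodule R Q₀) :=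
      (Submodule.mem_iInf _).2 hall
    rw [Ideal.iInf_pow_smul_eq_bot_of_isLocalRing _ (maximalIdeal.isMaximal R).ne_top] at this
    exact hne this
  obtain ⟨K, hK, hu⟩ := IsSocleGenerator.exists_mkQ _ hj
  obtain ⟨k, L, ⟨e⟩⟩ := exists_quotient_fin_equiv (R := R) (Q := Q₀ ⧸ K)
  refine ⟨_, _, _, inferInstance, e (K.mkQ ⟨z, hz₀⟩), j, hu.map_equiv e, ?_, ?_⟩
  · rw [← e.annihilator_eq]
    intro a ha
    rw [Module.mem_annihilator]
    intro y
    obtain ⟨y, rfl⟩ := K.mkQ_surjective y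
    rw [← map_smul]
    exact (Submodule.Quotient.mk_eq_zero _).2 (hK (Submodule.smul_mem_smul ha trivial))
  · rw [← e.coe_toLinearMap, ← LinearMap.comp_apply, ← LinearMap.lTensor_tmul, h₀, map_zero]

end Purity

/-! ### The impurity ideal as the annihilator of one element -/

section ImpurityIdeal

variable (A : Type u) (B : Type*) [CommRing A] [CommRing B] [Algebra A B]
  {M : Type*} [AddCommGroup M] [Module A M] [Module B M] [IsScalarTower A B M]

/-- The ideal of `B` generated by the `b` for which `A → M`, `1 ↦ b • n`, is not pure. -/
def impurityIdeal (n : M) : Ideal B :=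
  Ideal.span {b : B | ¬ IsPureMap (LinearMap.toSpanSingleton A M (b • n))}

variable {A B}

theorem torsionOf_tmul_le_impurityIdeal (n : M) {Q : Type*} [AddCommGroup Q] [Module A Q]
    [Module.Finite A Q] {z : Q} (hz : z ≠ 0) :
    Ideal.torsionOf B (M ⊗[A] Q) (n ⊗ₜ z) ≤ impurityIdeal A B n := fun b hb =>
  Ideal.subset_span (not_isPureMap_of_tmul_eq_zero hz
    (by rwa [Ideal.mem_torsionOf_iff, TensorProduct.smul_tmul'] at hb))

/-- The annihilators of the elements `n ⊗ z` form a directed family, by amalgamation of the test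
modules, and every `b` giving an impure map lies in one of them. A maximal member, which exists as
`B` is Noetherian, is therefore the whole ideal. -/
theorem exists_torsionOf_eq_impurityIdeal [IsNoetherianRing A] [IsLocalRing A]
    [IsNoetherianRing B] (n : M) :
    ∃ (Q : Type u) (_ : AddCommGroup Q) (_ : Module A Q) (_ : Module.Finite A Q) (z : Q) (j : ℕ),
      IsSocleGenerator A z ∧ maximalIdeal A ^ j ≤ Module.annihilator A Q ∧
      Ideal.torsionOf B (M ⊗[A] Q) (n ⊗ₜ z) = impurityIdeal A B n := by
  let 𝒮 : Set (Ideal B) := {I | ∃ (Q : Type u) (_ : AddCommGroup Q) (_ : Module A Q)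
    (_ : Module.Finite A Q) (z : Q) (j : ℕ), IsSocleGenerator A z ∧
      maximalIdeal A ^ j ≤ Module.annihilator A Q ∧
      Ideal.torsionOf B (M ⊗[A] Q) (n ⊗ₜ z) = I}
  have hne : 𝒮.Nonempty := by
    have h0 : ¬ IsPureMap (LinearMap.toSpanSingleton A M ((0 : B) • n)) :=
      not_isPureMap_of_tmul_eq_zero (Q := A) one_ne_zero (by rw [zero_smul, zero_tmul])
    obtain ⟨Q, _, _, _, z, j, hz, hj, -⟩ := exists_of_not_isPureMap h0
    exact ⟨_, Q, _, _, ‹_›, z, j, hz, hj, rfl⟩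
  obtain ⟨I, ⟨Q, _, _, _, z, j, hz, hj, rfl⟩, hmax⟩ :=
    set_has_maximal_iff_noetherian.2 ‹IsNoetherianRing B› 𝒮 hne
  refine ⟨Q, _, _, ‹_›, z, j, hz, hj,
    (torsionOf_tmul_le_impurityIdeal n hz.1).antisymm (Ideal.span_le.2 fun b hb => ?_)⟩
  obtain ⟨Q', _, _, _, z', j', hz', hj', hb'⟩ := exists_of_not_isPureMap hb
  obtain ⟨P, _, _, _, i, i', -, -, heq, hP, hann⟩ := IsSocleGenerator.exists_amalgam hz hz'
  have hle : ∀ {Q : Type u} [AddCommGroup Q] [Module A Q] (z : Q) (i : Q →ₗ[A] P),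
      Ideal.torsionOf B (M ⊗[A] Q) (n ⊗ₜ z) ≤ Ideal.torsionOf B (M ⊗[A] P) (n ⊗ₜ i z) := by
    intro Q _ _ z i b hb
    rw [Ideal.mem_torsionOf_iff, TensorProduct.smul_tmul'] at hb ⊢
    rw [← LinearMap.lTensor_tmul, hb, map_zero]
  have hmem : Ideal.torsionOf B (M ⊗[A] P) (n ⊗ₜ i z) ∈ 𝒮 :=
    ⟨P, _, _, ‹_›, i z, max j j', hP, le_trans (le_inf
      ((Ideal.pow_le_pow_right (le_max_left j j')).trans hj)
      ((Ideal.pow_le_pow_right (le_max_right j j')).trans hj')) hann, rfl⟩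
  have hmem' : b ∈ Ideal.torsionOf B (M ⊗[A] P) (n ⊗ₜ i z) := by
    rw [heq]
    refine hle z' i' ?_
    rw [Ideal.mem_torsionOf_iff, TensorProduct.smul_tmul', hb']
  have := (hle z i).eq_or_lt
  rcases this with h | h
  · exact h ▸ hmem'
  · exact absurd h (hmax _ hmem)

/-- The elements giving impure maps thus already form an ideal, and taking the span adds nothing. -/
theorem not_isPureMap_of_mem_impurityIdeal [IsNoetherianRing A] [IsLocalRing A]
    [IsNoetherianRing B] {n : M} {b : B} (hb : b ∈ impurityIdeal A B n) :
    ¬ IsPureMap (LinearMap.toSpanSingleton A M (b • n)) := by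
  obtain ⟨Q, _, _, _, z, j, hz, -, h⟩ := exists_torsionOf_eq_impurityIdeal (A := A) (B := B) n
  rw [← h, Ideal.mem_torsionOf_iff, TensorProduct.smul_tmul'] at hb
  exact not_isPureMap_of_tmul_eq_zero hz.1 hb

/-- The maximal ideal kills socle generators. For `B = F^e_* A` this puts `a ^ p ^ e` in the
degeneracy ideal for every `a ∈ 𝔪`, whence finite colength. -/
theorem map_maximalIdeal_le_impurityIdeal [IsNoetherianRing A] [IsLocalRing A]
    [IsNoetherianRing B] (n : M) :
    (maximalIdeal A).map (algebraMap A B) ≤ impurityIdeal A B n := by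
  obtain ⟨Q, _, _, _, z, j, hz, -, h⟩ := exists_torsionOf_eq_impurityIdeal (A := A) (B := B) n
  rw [Ideal.map_le_iff_le_comap, ← h]
  intro a ha
  rw [Ideal.mem_comap, Ideal.mem_torsionOf_iff, algebraMap_smul, ← TensorProduct.tmul_smul,
    hz.smul_eq_zero ha, tmul_zero]

end ImpurityIdeal

/-! ### Powers of regular sequences: socles, colons and lengths -/

section RegularSequence

open RingTheory.Sequence

variable {R : Type*} [CommRing R] {C : Type*} [AddCommGroup C] [Module R C]

theorem ofList_perm {l l' : List R} (h : l.Perm l') : Ideal.ofList l = Ideal.ofList l' :=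
  congrArg Ideal.span (Set.ext fun _ => h.mem_iff)

theorem ofList_cons_smul_top (x : R) (l : List R) :
    (Ideal.ofList (x :: l) • ⊤ : Submodule R C) =
      Ideal.ofList l • ⊤ ⊔ (Ideal.span {x} • ⊤ : Submodule R C) := by
  rw [Ideal.ofList_cons, Submodule.sup_smul, sup_comm]

theorem mem_sup_span_singleton_smul_top {L : Submodule R C} {x : R} {z : C} :
    z ∈ L ⊔ (Ideal.span {x} • ⊤ : Submodule R C) ↔ ∃ c : C, z - x • c ∈ L := by
  rw [Submodule.ideal_span_singleton_smul, Submodule.mem_sup]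
  constructor
  · rintro ⟨l, hl, y, hy, rfl⟩
    obtain ⟨c, -, rfl⟩ := Submodule.mem_smul_pointwise_iff_exists _ _ _ |>.1 hy
    exact ⟨c, by simpa using hl⟩
  · rintro ⟨c, hc⟩
    exact ⟨_, hc, x • c, Submodule.smul_mem_pointwise_smul _ _ _ trivial, by simp⟩

variable {L : Submodule R C} {x : R}

theorem IsSMulRegular.pow_smul_mem (h : IsSMulRegular (C ⧸ L) x) (t : ℕ) {z : C}
    (hz : x ^ t • z ∈ L) : z ∈ L :=
  mem_of_isSMulRegular_quotient_of_smul_mem (h.pow t) hz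

theorem mem_sup_of_pow_smul_mem_sup (h : IsSMulRegular (C ⧸ L) x) (t : ℕ) {z : C}
    (hz : x ^ t • z ∈ L ⊔ (Ideal.span {x ^ (t + 1)} • ⊤ : Submodule R C)) :
    z ∈ L ⊔ (Ideal.span {x} • ⊤ : Submodule R C) := by
  obtain ⟨c, hc⟩ := mem_sup_span_singleton_smul_top.1 hz
  refine mem_sup_span_singleton_smul_top.2 ⟨c, h.pow_smul_mem t ?_⟩
  rwa [smul_sub, smul_smul, ← pow_succ]

/-- Multiplication by `x ^ t` embeds `C ⧸ (L + xC)` in `C ⧸ (L + x ^ (t + 1) C)`, and every nonzero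
element of the target has a nonzero multiple in the image, because a power of `x` kills the target.
-/
theorem isSocleGenerator_sup_pow (h : IsSMulRegular (C ⧸ L) x) {u : C}
    (hu : IsSocleGenerator R ((L ⊔ (Ideal.span {x} • ⊤ : Submodule R C)).mkQ u)) (t : ℕ) :
    IsSocleGenerator R
      ((L ⊔ (Ideal.span {x ^ (t + 1)} • ⊤ : Submodule R C)).mkQ (x ^ t • u)) := by
  rw [IsSocleGenerator.mkQ_iff] at hu ⊢
  refine ⟨fun hmem => hu.1 (mem_sup_of_pow_smul_mem_sup h t hmem), fun z hz => ?_⟩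
  -- The last nonzero `x ^ k • z` is killed by `x`, so, `x` being regular modulo `L`, it has the
  -- form `x ^ t • c` modulo `L` with `c` nonzero modulo `L + xC`.
  have hex : ∃ k, x ^ k • z ∈ L ⊔ (Ideal.span {x ^ (t + 1)} • ⊤ : Submodule R C) :=
    ⟨t + 1, mem_sup_span_singleton_smul_top.2 ⟨z, by simp⟩⟩
  classical
  obtain ⟨k, hk⟩ : ∃ k, Nat.find hex = k + 1 := Nat.exists_eq_succ_of_ne_zero fun h0 => hz (by
    simpa [h0] using Nat.find_spec hex)
  have hk1 := hk ▸ Nat.find_spec hex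
  have hk0 := Nat.find_min hex (m := k) (by omega)
  obtain ⟨c, hc⟩ := mem_sup_span_singleton_smul_top.1 hk1
  have hc' : x ^ k • z - x ^ t • c ∈ L := by
    refine h.pow_smul_mem 1 ?_
    rwa [pow_one, smul_sub, smul_smul, smul_smul, ← pow_succ', ← pow_succ']
  have hcn : c ∉ L ⊔ (Ideal.span {x} • ⊤ : Submodule R C) := by
    intro hmem
    obtain ⟨d, hd⟩ := mem_sup_span_singleton_smul_top.1 hmem
    refine hk0 (mem_sup_span_singleton_smul_top.2 ⟨d, ?_⟩)
    have := add_mem hc' (L.smul_mem (x ^ t) hd)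
    rwa [smul_sub, smul_smul, ← pow_succ, sub_add_sub_cancel] at this
  obtain ⟨r, hr⟩ := hu.2 c hcn
  obtain ⟨d, hd⟩ := mem_sup_span_singleton_smul_top.1 hr
  refine ⟨r * x ^ k, mem_sup_span_singleton_smul_top.2 ⟨d, ?_⟩⟩
  have := add_mem (L.smul_mem r hc') (L.smul_mem (x ^ t) hd)
  convert this using 1
  simp only [smul_sub, smul_smul, pow_succ]
  rw [mul_comm r (x ^ t)]
  abel

/-- Additivity along `0 → C ⧸ (L + xC) → C ⧸ (L + x ^ (t + 1) C) → C ⧸ (L + x ^ t C) → 0`, whose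
first map is multiplication by `x ^ t`. -/
theorem length_quotient_sup_pow (h : IsSMulRegular (C ⧸ L) x) (t : ℕ) :
    Module.length R (C ⧸ L ⊔ (Ideal.span {x ^ t} • ⊤ : Submodule R C)) =
      t * Module.length R (C ⧸ L ⊔ (Ideal.span {x} • ⊤ : Submodule R C)) := by
  induction t with
  | zero =>
    have htop : L ⊔ (Ideal.span {x ^ 0} • ⊤ : Submodule R C) = ⊤ := by
      rw [pow_zero, Ideal.span_singleton_one, Submodule.top_smul, sup_top_eq]
    rw [htop]
    simp
  | succ t ih =>
    have hle : L ⊔ (Ideal.span {x ^ (t + 1)} • ⊤ : Submodule R C) ≤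
        L ⊔ (Ideal.span {x ^ t} • ⊤ : Submodule R C) := fun z hz => by
      obtain ⟨c, hc⟩ := mem_sup_span_singleton_smul_top.1 hz
      exact mem_sup_span_singleton_smul_top.2 ⟨x • c, by rwa [smul_smul, ← pow_succ]⟩
    have hle' : L ⊔ (Ideal.span {x} • ⊤ : Submodule R C) ≤
        (L ⊔ (Ideal.span {x ^ (t + 1)} • ⊤ : Submodule R C)).comap
          (LinearMap.lsmul R C (x ^ t)) := fun z hz => by
      obtain ⟨c, hc⟩ := mem_sup_span_singleton_smul_top.1 hz
      refine mem_sup_span_singleton_smul_top.2 ⟨c, ?_⟩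
      have := L.smul_mem (x ^ t) hc
      rwa [smul_sub, smul_smul, ← pow_succ] at this
    rw [Module.length_eq_add_of_exact (Submodule.mapQ _ _ _ hle') (Submodule.factor hle) ?_
      (Submodule.factor_surjective hle) ?_, ih, Nat.cast_succ, add_mul, one_mul, add_comm]
    · rw [injective_iff_map_eq_zero]
      intro z hz
      obtain ⟨z, rfl⟩ := Submodule.mkQ_surjective _ z
      rw [Submodule.mkQ_apply, Submodule.mapQ_apply, Submodule.Quotient.mk_eq_zero] at hz
      exact (Submodule.Quotient.mk_eq_zero _).2 (mem_sup_of_pow_smul_mem_sup h t hz)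
    · intro z
      obtain ⟨z, rfl⟩ := Submodule.mkQ_surjective _ z
      rw [Submodule.factor_mk, Submodule.mkQ_apply, Submodule.mkQ_apply,
        Submodule.Quotient.mk_eq_zero, mem_sup_span_singleton_smul_top]
      constructor
      · rintro ⟨c, hc⟩
        refine ⟨Submodule.Quotient.mk c, ?_⟩
        rw [Submodule.mapQ_apply, Submodule.Quotient.eq]
        refine Submodule.mem_sup_left ?_
        rw [← neg_mem_iff, neg_sub]
        exact hc
      · rintro ⟨c, hc⟩
        obtain ⟨c, rfl⟩ := Submodule.mkQ_surjective _ c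
        rw [Submodule.mkQ_apply, Submodule.mapQ_apply, Submodule.Quotient.eq,
          LinearMap.lsmul_apply] at hc
        obtain ⟨d, hd⟩ := mem_sup_span_singleton_smul_top.1 hc
        refine ⟨c - x • d, ?_⟩
        rw [← neg_mem_iff] at hd
        convert hd using 1
        rw [smul_sub, smul_smul, ← pow_succ]
        abel

/-- Over a local ring regular sequences may be permuted, so each element can be moved to the end and
raised to a power there. The list `l'` holds the elements not yet raised, which makes the induction
go through; the exponent `t + 1` keeps the powers in the maximal ideal. -/
theorem isWeaklyRegular_pow_append [IsLocalRing R] [IsNoetherian R C] (t : ℕ) (l : List R) :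
    ∀ l' : List R, (∀ y ∈ l ++ l', y ∈ maximalIdeal R) → IsWeaklyRegular C (l ++ l') →
      IsWeaklyRegular C (l.map (· ^ (t + 1)) ++ l') := by
  induction l with
  | nil => exact fun l' _ h => h
  | cons x l ih =>
    intro l' hm h
    have hperm : (x :: l ++ l').Perm (l ++ x :: l') := List.perm_middle.symm
    have h1 := ih (x :: l') (fun y hy => hm y (hperm.mem_iff.2 hy))
      (isWeaklyRegular_of_perm_of_subset_maximalIdeal h hperm hm)
    have hm1 : ∀ y ∈ l.map (· ^ (t + 1)) ++ x :: l', y ∈ maximalIdeal R := by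
      intro y hy
      rw [List.mem_append, List.mem_map] at hy
      rcases hy with ⟨a, ha, rfl⟩ | hy
      · exact Ideal.pow_mem_of_mem _ (hm a (by simp [ha])) _ (by omega)
      · exact hm y (by simp at hy ⊢; tauto)
    have h2 := isWeaklyRegular_of_perm_of_subset_maximalIdeal (rs' :=
      (l.map (· ^ (t + 1)) ++ l') ++ [x]) h1
      (List.perm_middle.trans (List.perm_append_singleton _ _).symm) hm1
    rw [isWeaklyRegular_append_iff, isWeaklyRegular_singleton_iff] at h2
    have h3 : IsWeaklyRegular C ((l.map (· ^ (t + 1)) ++ l') ++ [x ^ (t + 1)]) := by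
      rw [isWeaklyRegular_append_iff, isWeaklyRegular_singleton_iff]
      exact ⟨h2.1, h2.2.pow _⟩
    refine isWeaklyRegular_of_perm_of_subset_maximalIdeal h3
      (List.perm_append_singleton _ _) fun y hy => ?_
    rw [List.mem_append, List.mem_singleton] at hy
    rcases hy with hy | rfl
    · rw [List.mem_append] at hy
      exact hm1 y (List.mem_append.2 (hy.imp_right (List.mem_cons_of_mem x)))
    · exact Ideal.pow_mem_of_mem _ (hm x (by simp)) _ (by omega)

theorem isSMulRegular_quotient_pow_append [IsLocalRing R] [IsNoetherian R C] (t : ℕ) (x : R)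
    (l l' : List R) (hm : ∀ y ∈ x :: l ++ l', y ∈ maximalIdeal R)
    (h : IsWeaklyRegular C (x :: l ++ l')) :
    IsSMulRegular (C ⧸ (Ideal.ofList (l.map (· ^ (t + 1)) ++ l') • ⊤ : Submodule R C)) x := by
  have hperm : (x :: l ++ l').Perm (l ++ (l' ++ [x])) :=
    (List.perm_append_singleton x (l ++ l')).symm.trans (by rw [List.append_assoc])
  have h1 := isWeaklyRegular_pow_append t l (l' ++ [x]) (fun y hy => hm y (hperm.mem_iff.2 hy))
      (isWeaklyRegular_of_perm_of_subset_maximalIdeal h hperm hm)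
  rw [← List.append_assoc, isWeaklyRegular_append_iff, isWeaklyRegular_singleton_iff] at h1
  exact h1.2

variable [IsLocalRing R] [IsNoetherian R C]

/-- The exponents are raised one element at a time, each step multiplying the socle generator by `x
^ t`. -/
theorem isSocleGenerator_pow_append (t : ℕ) {u : C} (l : List R) :
    ∀ l' : List R, (∀ y ∈ l ++ l', y ∈ maximalIdeal R) → IsWeaklyRegular C (l ++ l') →
      IsSocleGenerator R ((Ideal.ofList (l ++ l') • ⊤ : Submodule R C).mkQ u) →
      IsSocleGenerator R ((Ideal.ofList (l.map (· ^ (t + 1)) ++ l') • ⊤ : Submodule R C).mkQ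
        (l.prod ^ t • u)) := by
  induction l with
  | nil => intro l' _ _ h; simpa using h
  | cons x l ih =>
    intro l' hm h hu
    have hperm : (x :: l ++ l').Perm (l ++ x :: l') := List.perm_middle.symm
    rw [ofList_perm hperm] at hu
    have h1 := ih (x :: l') (fun y hy => hm y (hperm.mem_iff.2 hy))
      (isWeaklyRegular_of_perm_of_subset_maximalIdeal h hperm hm) hu
    rw [ofList_perm List.perm_middle, ofList_cons_smul_top] at h1
    rw [List.map_cons, List.cons_append, ofList_cons_smul_top, List.prod_cons, mul_pow, mul_smul]
    exact isSocleGenerator_sup_pow (isSMulRegular_quotient_pow_append t x l l' hm h) h1 t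

/-- The colon identity `(x_i ^ (t + 1)) : (∏ x_i) ^ t = (x_i)`, obtained by cancelling one factor
`x_i ^ t` at a time. -/
theorem mem_of_prod_pow_smul_mem (t : ℕ) {u : C} (l : List R) :
    ∀ l' : List R, (∀ y ∈ l ++ l', y ∈ maximalIdeal R) → IsWeaklyRegular C (l ++ l') →
      l.prod ^ t • u ∈ (Ideal.ofList (l.map (· ^ (t + 1)) ++ l') • ⊤ : Submodule R C) →
      u ∈ (Ideal.ofList (l ++ l') • ⊤ : Submodule R C) := by
  induction l with
  | nil => intro l' _ _ h; simpa using h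
  | cons x l ih =>
    intro l' hm h hu
    have hperm : (x :: l ++ l').Perm (l ++ x :: l') := List.perm_middle.symm
    rw [ofList_perm hperm]
    refine ih (x :: l') (fun y hy => hm y (hperm.mem_iff.2 hy))
      (isWeaklyRegular_of_perm_of_subset_maximalIdeal h hperm hm) ?_
    rw [ofList_perm List.perm_middle, ofList_cons_smul_top]
    rw [List.map_cons, List.cons_append, ofList_cons_smul_top, List.prod_cons, mul_pow,
      mul_smul] at hu
    exact mem_sup_of_pow_smul_mem_sup (isSMulRegular_quotient_pow_append t x l l' hm h) t hu

theorem length_quotient_pow_append (t : ℕ) (l : List R) :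
    ∀ l' : List R, (∀ y ∈ l ++ l', y ∈ maximalIdeal R) → IsWeaklyRegular C (l ++ l') →
      Module.length R (C ⧸ (Ideal.ofList (l.map (· ^ (t + 1)) ++ l') • ⊤ : Submodule R C)) =
      ((t + 1) ^ l.length : ℕ) *
        Module.length R (C ⧸ (Ideal.ofList (l ++ l') • ⊤ : Submodule R C)) := by
  induction l with
  | nil =>
    intro l' _ _
    rw [List.map_nil, List.length_nil, pow_zero, Nat.cast_one, one_mul]
  | cons x l ih =>
    intro l' hm h
    have hperm : (x :: l ++ l').Perm (l ++ x :: l') := List.perm_middle.symm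
    have h1 := ih (x :: l') (fun y hy => hm y (hperm.mem_iff.2 hy))
      (isWeaklyRegular_of_perm_of_subset_maximalIdeal h hperm hm)
    rw [ofList_perm List.perm_middle, ofList_cons_smul_top] at h1
    rw [List.map_cons, List.cons_append, ofList_cons_smul_top,
      length_quotient_sup_pow (isSMulRegular_quotient_pow_append t x l l' hm h), h1,
      ofList_perm hperm, List.length_cons, pow_succ', ← mul_assoc, ← Nat.cast_mul]

end RegularSequence

/-! ### Annihilators and quotients under flat base change -/

section Flat

variable {A : Type*} [CommRing A]

/-- For a flat algebra the annihilator of an element commutes with base change. -/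
theorem mem_map_torsionOf_of_tmul_eq_zero {S : Type*} [CommRing S] [Algebra A S] [Module.Flat A S]
    {W : Type*} [AddCommGroup W] [Module A W] {w : W} {s : S} (h : s ⊗ₜ[A] w = 0) :
    s ∈ (Ideal.torsionOf A W w).map (algebraMap A S) := by
  let f : A →ₗ[A] W := LinearMap.toSpanSingleton A W w
  -- Flatness preserves the exactness of `Ann(w) → A → W`, whose second map is `1 ↦ w`.
  have hex : Function.Exact (Ideal.torsionOf A W w).subtype f := by
    rw [LinearMap.exact_iff, Submodule.range_subtype]
    rfl
  have hex' := Module.Flat.lTensor_exact S hex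
  have h1 : s ⊗ₜ[A] (1 : A) ∈ LinearMap.range ((Ideal.torsionOf A W w).subtype.lTensor S) := by
    rw [← (LinearMap.exact_iff.1 hex')]
    simpa [f] using h
  obtain ⟨t, ht⟩ := h1
  have h2 := congrArg (TensorProduct.rid A S) ht
  rw [TensorProduct.rid_tmul, one_smul] at h2
  rw [← h2]
  clear ht h2
  induction t with
  | zero => simp
  | add x y hx hy => rw [map_add, map_add]; exact add_mem hx hy
  | tmul x y =>
    rw [LinearMap.lTensor_tmul, TensorProduct.rid_tmul, Algebra.smul_def]
    exact Ideal.mul_mem_right _ _ (Ideal.mem_map_of_mem _ y.2)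

theorem tmul_eq_zero_of_mem_map_torsionOf {S : Type*} [CommRing S] [Algebra A S]
    {W : Type*} [AddCommGroup W] [Module A W] {w : W} {s : S}
    (h : s ∈ (Ideal.torsionOf A W w).map (algebraMap A S)) : s ⊗ₜ[A] w = 0 := by
  have hle : (Ideal.torsionOf A W w).map (algebraMap A S) ≤
      Ideal.torsionOf S (S ⊗[A] W) (1 ⊗ₜ w) := by
    rw [Ideal.map_le_iff_le_comap]
    intro a ha
    rw [Ideal.mem_comap, Ideal.mem_torsionOf_iff, algebraMap_smul, ← TensorProduct.tmul_smul,
      (Ideal.mem_torsionOf_iff _ _).1 ha, tmul_zero]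
  simpa [TensorProduct.smul_tmul'] using (Ideal.mem_torsionOf_iff _ _).1 (hle h)

variable {R : Type*} [CommRing R] [Algebra A R]

/-- Tensoring on the right commutes with killing an element. -/
def quotSMulTopTensorEquiv (y : R) (S Q : Type*) [AddCommGroup S] [Module R S] [Module A S]
    [IsScalarTower A R S] [AddCommGroup Q] [Module A Q] :
    QuotSMulTop y S ⊗[A] Q ≃ₗ[R] QuotSMulTop y (S ⊗[A] Q) :=
  (AlgebraTensorModule.congr (QuotSMulTop.equivQuotTensor y S) (LinearEquiv.refl A Q)) ≪≫ₗ
    AlgebraTensorModule.assoc A R R (R ⧸ Ideal.span {y}) S Q ≪≫ₗ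
    (QuotSMulTop.equivQuotTensor y (S ⊗[A] Q)).symm

theorem mem_smul_top_of_rTensor_mkQ_eq_zero {S Q : Type*} [AddCommGroup S] [Module R S] [Module A S]
    [IsScalarTower A R S] [AddCommGroup Q] [Module A Q] {J : Ideal R} {L : Submodule R S}
    (hL : L = J • ⊤) {z : S ⊗[A] Q} (hz : (L.mkQ.restrictScalars A).rTensor Q z = 0) :
    z ∈ (J • ⊤ : Submodule R (S ⊗[A] Q)) := by
  have hex : Function.Exact (L.subtype.restrictScalars A) (L.mkQ.restrictScalars A) :=
    LinearMap.exact_subtype_mkQ L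
  obtain ⟨t, rfl⟩ := (rTensor_exact Q hex L.mkQ_surjective z).1 hz
  clear hz
  induction t with
  | zero => simp
  | add x y hx hy => rw [map_add]; exact add_mem hx hy
  | tmul x y =>
    obtain ⟨x, hx⟩ := x
    change x ⊗ₜ[A] y ∈ _
    subst hL
    refine Submodule.smul_induction_on hx (fun j hj s _ => ?_) fun s s' hs hs' => ?_
    · rw [← TensorProduct.smul_tmul']
      exact Submodule.smul_mem_smul hj trivial
    · rw [add_tmul]
      exact add_mem hs hs'

end Flat

/-! ### Finite length from a power of the maximal ideal -/

section FiniteLength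

variable {A : Type*} [CommRing A] [IsLocalRing A] [IsNoetherianRing A]

theorem isFiniteLength_of_pow_le_annihilator (j : ℕ) :
    ∀ {M : Type*} [AddCommGroup M] [Module A M] [Module.Finite A M],
      maximalIdeal A ^ j ≤ Module.annihilator A M → IsFiniteLength A M := by
  induction j with
  | zero =>
    intro M _ _ _ h
    rw [pow_zero, Ideal.one_eq_top, top_le_iff, Module.annihilator_eq_top_iff] at h
    exact .of_subsingleton
  | succ j ih =>
    intro M _ _ _ h
    let N : Submodule A M := maximalIdeal A • ⊤
    have hs : IsSimpleModule A (A ⧸ maximalIdeal A) :=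
      isSimpleModule_iff_quot_maximal.2 ⟨_, maximalIdeal.isMaximal A, ⟨LinearEquiv.refl _ _⟩⟩
    have hN : IsFiniteLength A N := ih fun a ha => by
      rw [Module.mem_annihilator]
      rintro ⟨z, hz⟩
      refine Subtype.ext ?_
      change a • z = 0
      refine Submodule.smul_induction_on hz (fun b hb y _ => ?_) fun y y' hy hy' => ?_
      · rw [smul_smul]
        exact Module.mem_annihilator.1 (h (by rw [pow_succ]; exact Ideal.mul_mem_mul ha hb)) y
      · rw [smul_add, hy, hy', add_zero]
    have hQ : IsFiniteLength A (M ⧸ N) := by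
      refine isFiniteLength_of_le_annihilator (J := maximalIdeal A) (fun a ha => ?_)
        (isFiniteLength_iff_isNoetherian_isArtinian.2 ⟨inferInstance, inferInstance⟩)
      rw [Module.mem_annihilator]
      intro y
      obtain ⟨y, rfl⟩ := N.mkQ_surjective y
      rw [← map_smul]
      exact (Submodule.Quotient.mk_eq_zero _).2 (Submodule.smul_mem_smul ha trivial)
    rw [← Module.length_ne_top_iff] at hN hQ ⊢
    rw [Module.length_eq_add_of_exact N.subtype N.mkQ N.injective_subtype N.mkQ_surjective
      (LinearMap.exact_subtype_mkQ N)]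
    exact WithTop.add_ne_top.2 ⟨hN, hQ⟩

theorem isFiniteLength_quotient_of_pow_le {j : ℕ} {I : Ideal A} (h : maximalIdeal A ^ j ≤ I) :
    IsFiniteLength A (A ⧸ I) :=
  isFiniteLength_of_pow_le_annihilator j (by rwa [Ideal.annihilator_quotient])

end FiniteLength

/-! ### Regular elements on the closed fibre and the local criterion of flatness -/

section LocalFlatness

variable {A R : Type*} [CommRing A] [CommRing R] [Algebra A R] [IsLocalRing A]
  {S : Type*} [AddCommGroup S] [Module R S] [Module A S] [IsScalarTower A R S] [Module.Flat A S]

/-- Flatness of `S` keeps a composition series of `Q` exact after tensoring, every simple factor is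
the residue field, and regularity passes to extensions. -/
theorem isSMulRegular_tensor_of_isFiniteLength {y : R}
    (hy : IsSMulRegular (S ⊗[A] (A ⧸ maximalIdeal A)) y) {Q : Type*} [AddCommGroup Q] [Module A Q]
    (hQ : IsFiniteLength A Q) : IsSMulRegular (S ⊗[A] Q) y := by
  induction hQ with
  | of_subsingleton =>
    exact fun a b _ => Subsingleton.elim a b
  | @of_simple_quotient Q _ _ N hS _ ih =>
    obtain ⟨I, hI, ⟨e⟩⟩ := isSimpleModule_iff_quot_maximal.1 hS
    obtain rfl := eq_maximalIdeal hI
    have hq : IsSMulRegular (S ⊗[A] (Q ⧸ N)) y :=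
      (AlgebraTensorModule.congr (LinearEquiv.refl R S) e).isSMulRegular_congr y |>.2 hy
    refine isSMulRegular_of_range_eq_ker
      (f := AlgebraTensorModule.lTensor R S N.subtype)
      (g := AlgebraTensorModule.lTensor R S N.mkQ) ?_ ?_ ih hq
    · exact Module.Flat.lTensor_preserves_injective_linearMap (M := S) _ N.injective_subtype
    · exact (LinearMap.exact_iff.1 (show Function.Exact (AlgebraTensorModule.lTensor R S N.subtype)
        (AlgebraTensorModule.lTensor R S N.mkQ) from
        lTensor_exact S (LinearMap.exact_subtype_mkQ N) N.mkQ_surjective)).symm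

theorem finite_tensor {A R : Type*} [CommRing A] [CommRing R] [Algebra A R] {S : Type*}
    [AddCommGroup S] [Module R S] [Module A S] [IsScalarTower A R S] [Module.Finite R S]
    (Q : Type*) [AddCommGroup Q] [Module A Q] [Module.Finite A Q] :
    Module.Finite R (S ⊗[A] Q) :=
  Module.Finite.equiv (AlgebraTensorModule.cancelBaseChange A R R S Q)

variable [IsNoetherianRing A] [IsLocalRing R] [IsNoetherianRing R]
  [IsLocalHom (algebraMap A R)] [Module.Finite R S]

/-- An element killed by `y` vanishes in `S ⊗ (Q ⧸ 𝔪 ^ j Q)` for every `j`, by the finite length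
case, and Krull's intersection theorem over `R` then makes it zero. -/
theorem isSMulRegular_tensor_of_residue {y : R}
    (hy : IsSMulRegular (S ⊗[A] (A ⧸ maximalIdeal A)) y) (Q : Type*) [AddCommGroup Q] [Module A Q]
    [Module.Finite A Q] : IsSMulRegular (S ⊗[A] Q) y := by
  have := finite_tensor (A := A) (R := R) (S := S) Q
  refine IsSMulRegular.of_right_eq_zero_of_smul fun z hz => ?_
  suffices h : z ∈ (⨅ j : ℕ, maximalIdeal R ^ j • ⊤ : Submodule R (S ⊗[A] Q)) by
    rwa [Ideal.iInf_pow_smul_eq_bot_of_isLocalRing _ (maximalIdeal.isMaximal R).ne_top] at h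
  refine (Submodule.mem_iInf _).2 fun j => ?_
  let N : Submodule A Q := maximalIdeal A ^ j • ⊤
  have hfl : IsFiniteLength A (Q ⧸ N) := isFiniteLength_of_pow_le_annihilator j fun a ha => by
    rw [Module.mem_annihilator]
    intro y
    obtain ⟨y, rfl⟩ := N.mkQ_surjective y
    rw [← map_smul]
    exact (Submodule.Quotient.mk_eq_zero _).2 (Submodule.smul_mem_smul ha trivial)
  have h0 : AlgebraTensorModule.lTensor R S N.mkQ z = 0 :=
    (isSMulRegular_tensor_of_isFiniteLength hy hfl).right_eq_zero_of_smul
      (by rw [← map_smul, hz, map_zero])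
  obtain ⟨t, rfl⟩ := (lTensor_exact S (LinearMap.exact_subtype_mkQ N) N.mkQ_surjective z).1 h0
  clear hz h0
  induction t with
  | zero => simp
  | add x y hx hy => rw [map_add]; exact add_mem hx hy
  | tmul s q =>
    obtain ⟨q, hq⟩ := q
    change s ⊗ₜ[A] q ∈ _
    refine Submodule.smul_induction_on hq (fun a ha q _ => ?_) fun q q' hq hq' => ?_
    · rw [TensorProduct.tmul_smul, ← algebraMap_smul R a]
      refine Submodule.smul_mem_smul ?_ trivial
      have h1 := Ideal.mem_map_of_mem (algebraMap A R) ha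
      rw [Ideal.map_pow] at h1
      exact Ideal.pow_right_mono (((local_hom_TFAE (algebraMap A R)).out 0 2 :
        IsLocalHom (algebraMap A R) ↔ _).1 inferInstance) j h1
    · rw [TensorProduct.tmul_add]
      exact add_mem hq hq'

/-- The reason is `Tor₁(S ⧸ yS, A ⧸ I) = 0`, as `y` is regular on `S` and on `S ⊗ A ⧸ I`.
Explicitly, lift a kernel element to `t ∈ S ⊗ I`. Its image in `S ⊗ A` is `y • z`, and `z` vanishes
in `S ⊗ A ⧸ I` by regularity. So `z` comes from some `z' ∈ S ⊗ I`, and `t = y • z'` dies in `(S ⧸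
yS) ⊗ I`. -/
theorem flat_quotient_of_residue {y : R} (hy : IsSMulRegular (S ⊗[A] (A ⧸ maximalIdeal A)) y)
    {L : Submodule R S} (hL : L = Ideal.span {y} • ⊤) : Module.Flat A (S ⧸ L) := by
  rw [Module.Flat.iff_lTensor_injective']
  intro I
  rw [injective_iff_map_eq_zero]
  intro t ht
  let π : S →ₗ[A] S ⧸ L := L.mkQ.restrictScalars A
  have hπ : Function.Surjective π := L.mkQ_surjective
  obtain ⟨t, rfl⟩ := LinearMap.rTensor_surjective I hπ t
  have h1 : π.rTensor A (I.subtype.lTensor S t) = 0 := by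
    rw [← LinearMap.comp_apply, LinearMap.rTensor_comp_lTensor, ← LinearMap.lTensor_comp_rTensor,
      LinearMap.comp_apply, ht]
  have h2 := mem_smul_top_of_rTensor_mkQ_eq_zero hL h1
  rw [Submodule.ideal_span_singleton_smul] at h2
  obtain ⟨z, -, hz⟩ := (Submodule.mem_smul_pointwise_iff_exists _ _ _).1 h2
  have hexact := lTensor_exact S (LinearMap.exact_subtype_mkQ I) I.mkQ_surjective
  have h3 : AlgebraTensorModule.lTensor R S I.mkQ z = 0 := by
    refine (isSMulRegular_tensor_of_residue hy (A ⧸ I)).right_eq_zero_of_smul ?_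
    rw [← map_smul, hz]
    exact hexact.apply_apply_eq_zero t
  obtain ⟨z', hz'⟩ := (hexact z).1 h3
  have h4 : t = y • z' := by
    have hinj := Module.Flat.lTensor_preserves_injective_linearMap (M := S) I.subtype
      I.injective_subtype
    refine hinj ?_
    rw [← hz, ← hz']
    exact ((AlgebraTensorModule.lTensor R S I.subtype).map_smul y z').symm
  have h5 : ∀ z' : S ⊗[A] I, π.rTensor I (y • z') = 0 := by
    intro z'
    induction z' with
    | zero => rw [smul_zero, map_zero]
    | add a b ha hb => rw [smul_add, map_add, ha, hb, add_zero]
    | tmul s a =>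
      have hs : π (y • s) = 0 := (Submodule.Quotient.mk_eq_zero L).2 (by
        rw [hL]
        exact Submodule.smul_mem_smul (Ideal.mem_span_singleton_self y) trivial)
      rw [TensorProduct.smul_tmul', LinearMap.rTensor_tmul, hs, zero_tmul]
  rw [h4, h5]

end LocalFlatness

/-! ### Sequences regular on the closed fibre -/

section RegularSequence

open RingTheory.Sequence

variable {A R : Type*} [CommRing A] [CommRing R] [Algebra A R] [IsLocalRing A]
  [IsNoetherianRing A] [IsLocalRing R] [IsNoetherianRing R] [IsLocalHom (algebraMap A R)]

/-- A sequence that is regular on the closed fibre of a flat module is regular after any finite base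
change, and its quotient is flat. -/
theorem isWeaklyRegular_tensor_and_flat (l : List R) :
    ∀ {S : Type*} [AddCommGroup S] [Module R S] [Module A S] [IsScalarTower A R S]
      [Module.Flat A S] [Module.Finite R S], IsWeaklyRegular (S ⊗[A] (A ⧸ maximalIdeal A)) l →
      (∀ (Q : Type w) [AddCommGroup Q] [Module A Q] [Module.Finite A Q],
        IsWeaklyRegular (S ⊗[A] Q) l) ∧
      Module.Flat A (S ⧸ (Ideal.ofList l • ⊤ : Submodule R S)) := by
  induction l with
  | nil =>
    intro S _ _ _ _ _ _ _
    refine ⟨fun Q _ _ _ => .nil R _, ?_⟩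
    let e : (S ⧸ (Ideal.ofList ([] : List R) • ⊤ : Submodule R S)) ≃ₗ[R] S :=
      Submodule.quotEquivOfEqBot _ (by rw [Ideal.ofList_nil, Submodule.bot_smul])
    exact Module.Flat.of_linearEquiv (e.restrictScalars A)
  | cons y l ih =>
    intro S _ _ _ _ _ _ h
    rw [isWeaklyRegular_cons_iff] at h
    have hflat : Module.Flat A (QuotSMulTop y S) :=
      flat_quotient_of_residue h.1 (Submodule.ideal_span_singleton_smul y ⊤).symm
    obtain ⟨h1, h2⟩ := ih (S := QuotSMulTop y S)
      ((quotSMulTopTensorEquiv y S (A ⧸ maximalIdeal A)).isWeaklyRegular_congr l |>.2 h.2)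
    refine ⟨fun Q _ _ _ => ?_, ?_⟩
    · rw [isWeaklyRegular_cons_iff]
      exact ⟨isSMulRegular_tensor_of_residue h.1 Q,
        (quotSMulTopTensorEquiv y S Q).isWeaklyRegular_congr l |>.1 (h1 Q)⟩
    · exact Module.Flat.of_linearEquiv
        ((Submodule.quotOfListConsSMulTopEquivQuotSMulTopInner S y l).restrictScalars A)

end RegularSequence

/-! ### Base change of simple socles -/

section FibreSocle

theorem exists_smul_ne_zero_of_pow_smul {A W : Type*} [CommRing A] [AddCommGroup W] [Module A W]
    {I : Ideal A} {j : ℕ} {z : W} (hz : z ≠ 0) (h : ∀ a ∈ I ^ j, a • z = 0) :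
    ∃ a : A, a • z ≠ 0 ∧ ∀ b ∈ I, b • a • z = 0 := by
  induction j with
  | zero => exact absurd (by simpa using h 1 (by simp)) hz
  | succ j ih =>
    by_cases hj : ∀ a ∈ I ^ j, a • z = 0
    · exact ih hj
    · push Not at hj
      obtain ⟨a, ha, hne⟩ := hj
      refine ⟨a, hne, fun b hb => ?_⟩
      rw [smul_smul]
      exact h _ (by rw [pow_succ']; exact Ideal.mul_mem_mul hb ha)

variable {A : Type*} [CommRing A]

/-- The socle of `Q` is the kernel of `Q → Q ^ G`, multiplication by a finite generating set `G` of
the maximal ideal, and kernels commute with the flat functor `S ⊗ -`. -/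
theorem exists_tmul_eq_of_smul_eq_zero [IsLocalRing A] [IsNoetherianRing A] {S Q : Type*}
    [AddCommGroup S] [Module A S] [Module.Flat A S] [AddCommGroup Q] [Module A Q] {u : Q}
    (hu : IsSocleGenerator A u) {z : S ⊗[A] Q} (hz : ∀ a ∈ maximalIdeal A, a • z = 0) :
    ∃ s : S, z = s ⊗ₜ u := by
  classical
  obtain ⟨G, hG⟩ := (maximalIdeal A).fg_of_isNoetherianRing
  have hGm : ∀ a ∈ G, a ∈ maximalIdeal A := fun a ha => hG ▸ Ideal.subset_span ha
  let f : Q →ₗ[A] (G → Q) := LinearMap.pi fun a => LinearMap.lsmul A Q (a : A)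
  have hex : Function.Exact (Submodule.span A {u}).subtype f := by
    rw [LinearMap.exact_iff, Submodule.range_subtype]
    refine le_antisymm (fun q hq => hu.mem_span_of_smul_eq_zero fun a ha => ?_)
      ((Submodule.span_singleton_le_iff_mem _ _).2 (funext fun a => hu.smul_eq_zero (hGm a a.2)))
    have hle : maximalIdeal A ≤ Ideal.torsionOf A Q q := by
      rw [← hG]
      exact Ideal.span_le.2 fun b hb => congrFun hq ⟨b, hb⟩
    exact (Ideal.mem_torsionOf_iff _ _).1 (hle ha)
  have h0 : f.lTensor S z = 0 := by
    apply (TensorProduct.piRight A A S (fun _ : G => Q)).injective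
    ext a
    have hcomp : LinearMap.proj a ∘ₗ (TensorProduct.piRight A A S (fun _ : G => Q)).toLinearMap ∘ₗ
        f.lTensor S = LinearMap.lsmul A (S ⊗[A] Q) (a : A) :=
      TensorProduct.ext' fun s q => by simp [f]
    have := LinearMap.congr_fun hcomp z
    simpa [hz a (hGm a a.2)] using this
  obtain ⟨t, rfl⟩ := (Module.Flat.lTensor_exact S hex z).1 h0
  clear hz h0
  induction t with
  | zero => exact ⟨0, by simp⟩
  | add x y hx hy =>
    obtain ⟨s, hs⟩ := hx
    obtain ⟨s', hs'⟩ := hy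
    exact ⟨s + s', by rw [map_add, hs, hs', add_tmul]⟩
  | tmul s q =>
    obtain ⟨q, hq⟩ := q
    obtain ⟨a, rfl⟩ := Submodule.mem_span_singleton.1 hq
    exact ⟨a • s, by rw [TensorProduct.smul_tmul]; rfl⟩

variable {R : Type*} [CommRing R] [Algebra A R] {J : Ideal R}

theorem rTensor_mk_eq_zero_of_mem_smul_top {Q : Type*} [AddCommGroup Q] [Module A Q]
    {z : R ⊗[A] Q} (hz : z ∈ (J • ⊤ : Submodule R (R ⊗[A] Q))) :
    (Ideal.Quotient.mkₐ A J).toLinearMap.rTensor Q z = 0 := by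
  have key : ∀ j ∈ J, ∀ z : R ⊗[A] Q,
      (Ideal.Quotient.mkₐ A J).toLinearMap.rTensor Q (j • z) = 0 := by
    intro j hj z
    induction z with
    | zero => rw [smul_zero, map_zero]
    | add x y hx hy => rw [smul_add, map_add, hx, hy, add_zero]
    | tmul r q =>
      have : (Ideal.Quotient.mkₐ A J).toLinearMap (j • r) = 0 :=
        Ideal.Quotient.eq_zero_iff_mem.2 (Ideal.mul_mem_right r J hj)
      rw [TensorProduct.smul_tmul', LinearMap.rTensor_tmul, this, zero_tmul]
  refine Submodule.smul_induction_on hz (fun j hj z _ => key j hj z) fun x y hx hy => ?_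
  rw [map_add, hx, hy, add_zero]

theorem mem_smul_top_iff_rTensor_mk_eq_zero {Q : Type*} [AddCommGroup Q] [Module A Q]
    {z : R ⊗[A] Q} : z ∈ (J • ⊤ : Submodule R (R ⊗[A] Q)) ↔
      (Ideal.Quotient.mkₐ A J).toLinearMap.rTensor Q z = 0 :=
  ⟨rTensor_mk_eq_zero_of_mem_smul_top, fun h =>
    mem_smul_top_of_rTensor_mkQ_eq_zero (L := J) (by rw [smul_eq_mul, Ideal.mul_top]) h⟩

/-- For `R ⧸ J` flat over `A`, the annihilator of an element of `W` commutes with base change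
modulo `J`. -/
theorem tmul_mem_smul_top_iff [Module.Flat A (R ⧸ J)] {W : Type*} [AddCommGroup W] [Module A W]
    {w : W} {r : R} : r ⊗ₜ w ∈ (J • ⊤ : Submodule R (R ⊗[A] W)) ↔
      r ∈ (Ideal.torsionOf A W w).map (algebraMap A R) ⊔ J := by
  have hmap : (Ideal.torsionOf A W w).map (algebraMap A (R ⧸ J)) =
      ((Ideal.torsionOf A W w).map (algebraMap A R)).map (Ideal.Quotient.mk J) := by
    rw [Ideal.map_map]
    rfl
  have hiff : r ∈ (Ideal.torsionOf A W w).map (algebraMap A R) ⊔ J ↔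
      Ideal.Quotient.mk J r ∈ (Ideal.torsionOf A W w).map (algebraMap A (R ⧸ J)) := by
    rw [hmap, ← Ideal.mem_comap, Ideal.comap_map_of_surjective _ Ideal.Quotient.mk_surjective,
      ← RingHom.ker_eq_comap_bot, Ideal.mk_ker]
  rw [mem_smul_top_iff_rTensor_mk_eq_zero, LinearMap.rTensor_tmul, hiff]
  exact ⟨mem_map_torsionOf_of_tmul_eq_zero, tmul_eq_zero_of_mem_map_torsionOf⟩

/-- The annihilator of a finite module is the annihilator of the tuple of its generators in `Q ^ k`,
which reduces the claim to a single element, where `tmul_mem_smul_top_iff` applies. -/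
theorem annihilator_quotient_smul_top [Module.Flat A (R ⧸ J)] (Q : Type*) [AddCommGroup Q]
    [Module A Q] [Module.Finite A Q] :
    Module.annihilator R ((R ⊗[A] Q) ⧸ (J • ⊤ : Submodule R (R ⊗[A] Q))) =
      (Module.annihilator A Q).map (algebraMap A R) ⊔ J := by
  refine le_antisymm (fun r hr => ?_) (sup_le (Ideal.map_le_iff_le_comap.2 fun a ha => ?_)
    fun r hr => ?_)
  · obtain ⟨k, q, hq⟩ := Module.Finite.exists_fin (R := A) (M := Q)
    have htor : Ideal.torsionOf A (Fin k → Q) q = Module.annihilator A Q := by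
      ext a
      rw [Ideal.mem_torsionOf_iff, ← Submodule.annihilator_top, ← hq,
        Submodule.mem_annihilator_span]
      exact ⟨fun h ⟨_, i, hi⟩ => hi ▸ congrFun h i, fun h => funext fun i => h ⟨_, i, rfl⟩⟩
    rw [← htor, ← tmul_mem_smul_top_iff]
    have hsum : r ⊗ₜ[A] q = ∑ i, (AlgebraTensorModule.lTensor R R
        (LinearMap.single A (fun _ : Fin k => Q) i)) (r • (1 : R) ⊗ₜ q i) := by
      simp only [TensorProduct.smul_tmul', smul_eq_mul, mul_one,
        AlgebraTensorModule.lTensor_tmul, ← TensorProduct.tmul_sum]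
      exact congrArg (r ⊗ₜ[A] ·) (LinearMap.sum_single_apply (fun _ => Q) q).symm
    rw [hsum]
    refine Submodule.sum_mem _ fun i _ => ?_
    have hmem : r • (1 : R) ⊗ₜ[A] q i ∈ (J • ⊤ : Submodule R (R ⊗[A] Q)) := by
      rw [← Submodule.Quotient.mk_eq_zero, Submodule.Quotient.mk_smul]
      exact Module.mem_annihilator.1 hr _
    have := Submodule.mem_map_of_mem (f := AlgebraTensorModule.lTensor R R
        (LinearMap.single A (fun _ : Fin k => Q) i)) hmem
    rw [Submodule.map_smul''] at this
    exact Submodule.smul_mono le_rfl le_top this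
  · rw [Ideal.mem_comap, Module.mem_annihilator]
    intro y
    obtain ⟨y, rfl⟩ := Submodule.mkQ_surjective _ y
    rw [algebraMap_smul, ← LinearMap.map_smul_of_tower]
    have : a • y = 0 := by
      induction y with
      | zero => rw [smul_zero]
      | add x y hx hy => rw [smul_add, hx, hy, add_zero]
      | tmul r q => rw [← TensorProduct.tmul_smul, Module.mem_annihilator.1 ha, tmul_zero]
    rw [this, map_zero]
  · rw [Module.mem_annihilator]
    intro y
    obtain ⟨y, rfl⟩ := Submodule.mkQ_surjective _ y
    rw [← map_smul]
    exact (Submodule.Quotient.mk_eq_zero _).2 (Submodule.smul_mem_smul hr trivial)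

/-- If `R ⧸ J` is flat over `A` with closed fibre a field, then simple socles base change to simple
socles. -/
theorem isSocleGenerator_mkQ_one_tmul [IsLocalRing A] [IsNoetherianRing A] [IsLocalRing R]
    [Module.Flat A (R ⧸ J)] (hmax : (maximalIdeal A).map (algebraMap A R) ⊔ J = maximalIdeal R)
    {Q : Type*} [AddCommGroup Q] [Module A Q] {u : Q} (hu : IsSocleGenerator A u) {j : ℕ}
    (hj : maximalIdeal A ^ j ≤ Module.annihilator A Q) :
    IsSocleGenerator R ((J • ⊤ : Submodule R (R ⊗[A] Q)).mkQ (1 ⊗ₜ u)) := by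
  rw [IsSocleGenerator.mkQ_iff]
  constructor
  · rw [tmul_mem_smul_top_iff, hu.torsionOf_eq, hmax]
    exact (maximalIdeal R).ne_top_iff_one.1 (maximalIdeal.isMaximal R).ne_top
  · intro z hz
    rw [mem_smul_top_iff_rTensor_mk_eq_zero] at hz
    -- A multiple of `z` is nonzero modulo `J` and killed by `𝔪`, so by flatness it is `r ⊗ u`
    -- modulo `J`. Nonunits of `R` lie in `𝔪R + J` and kill `1 ⊗ u` modulo `J`, so `r` is a unit.
    obtain ⟨a, ha, hma⟩ := exists_smul_ne_zero_of_pow_smul (A := A) (j := j) (I := maximalIdeal A)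
      hz fun a ha => by
        rw [← map_smul]
        have : a • z = 0 := by
          clear hz
          induction z with
          | zero => rw [smul_zero]
          | add x y hx hy => rw [smul_add, hx, hy, add_zero]
          | tmul r q => rw [← TensorProduct.tmul_smul, Module.mem_annihilator.1 (hj ha), tmul_zero]
        rw [this, map_zero]
    obtain ⟨s, hs⟩ := exists_tmul_eq_of_smul_eq_zero hu hma
    obtain ⟨r, rfl⟩ := Ideal.Quotient.mk_surjective s
    have hr : IsUnit r := by
      by_contra hnu
      refine ha ?_
      have h1 : r ⊗ₜ[A] u ∈ (J • ⊤ : Submodule R (R ⊗[A] Q)) := by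
        rw [tmul_mem_smul_top_iff, hu.torsionOf_eq, hmax]
        exact hnu
      rw [mem_smul_top_iff_rTensor_mk_eq_zero, LinearMap.rTensor_tmul] at h1
      rw [hs]
      exact h1
    obtain ⟨r', hr'⟩ := hr.exists_left_inv
    refine ⟨r' * algebraMap A R a, ?_⟩
    have h2 : a • z - r ⊗ₜ u ∈ (J • ⊤ : Submodule R (R ⊗[A] Q)) := by
      rw [mem_smul_top_iff_rTensor_mk_eq_zero, map_sub, map_smul, hs, LinearMap.rTensor_tmul]
      exact sub_self _
    have h3 := Submodule.smul_mem _ r' h2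
    rwa [smul_sub, TensorProduct.smul_tmul', smul_eq_mul, hr', ← algebraMap_smul R a, smul_smul]
      at h3

end FibreSocle

/-! ### The impurity ideal under flat local base change -/

section BaseChange

theorem lTensor_mkQ_eq_zero_iff {R T : Type*} [CommRing R] [CommRing T] [Algebra R T]
    {N V : Type*} [AddCommGroup N] [Module R N] [Module T N] [IsScalarTower R T N]
    [AddCommGroup V] [Module R V] {J : Ideal R} (X : N ⊗[R] V) :
    (J • ⊤ : Submodule R V).mkQ.lTensor N X = 0 ↔
      X ∈ (J.map (algebraMap R T) • ⊤ : Submodule T (N ⊗[R] V)) := by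
  let L : Submodule R V := J • ⊤
  constructor
  · intro h
    obtain ⟨t, rfl⟩ := (lTensor_exact N (LinearMap.exact_subtype_mkQ L) L.mkQ_surjective X).1 h
    clear h
    induction t with
    | zero => simp
    | add x y hx hy => rw [map_add]; exact add_mem hx hy
    | tmul m y =>
      obtain ⟨y, hy⟩ := y
      change m ⊗ₜ[R] y ∈ _
      refine Submodule.smul_induction_on hy (fun j hj y _ => ?_) fun y y' hy hy' => ?_
      · rw [TensorProduct.tmul_smul, ← algebraMap_smul T j]
        exact Submodule.smul_mem_smul (Ideal.mem_map_of_mem _ hj) trivial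
      · rw [TensorProduct.tmul_add]
        exact add_mem hy hy'
  · intro h
    have hann : J.map (algebraMap R T) ≤ Module.annihilator T (N ⊗[R] (V ⧸ L)) := by
      refine Ideal.map_le_iff_le_comap.2 fun j hj => ?_
      rw [Ideal.mem_comap, Module.mem_annihilator]
      intro y
      rw [algebraMap_smul]
      induction y with
      | zero => rw [smul_zero]
      | add x y hx hy => rw [smul_add, hx, hy, add_zero]
      | tmul m y =>
        obtain ⟨y, rfl⟩ := L.mkQ_surjective y
        rw [← TensorProduct.tmul_smul, ← map_smul, Submodule.mkQ_apply,
          (Submodule.Quotient.mk_eq_zero L).2 (Submodule.smul_mem_smul hj trivial), tmul_zero]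
    change AlgebraTensorModule.lTensor T N L.mkQ X = 0
    refine Submodule.smul_induction_on h (fun t ht y _ => ?_) fun y y' hy hy' => ?_
    · rw [map_smul]
      exact Module.mem_annihilator.1 (hann ht) _
    · rw [map_add, hy, hy', add_zero]

variable {A : Type u} {R : Type v} {B T : Type*} [CommRing A] [CommRing R] [CommRing B] [CommRing T]
  [Algebra A R] [Algebra A B] [Algebra R T] [Algebra B T] [Algebra A T] [IsScalarTower A B T]
  [IsScalarTower A R T] [SMulCommClass B R T] {M : Type*} [AddCommGroup M] [Module A M] [Module B M]
  [IsScalarTower A B M]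

/-- The base change isomorphism `M_T ⊗_R Q_R ≅ T ⊗_B (M ⊗_A Q)`. -/
def tensorBaseChangeEquiv (Q : Type*) [AddCommGroup Q] [Module A Q] :
    (T ⊗[B] M) ⊗[R] (R ⊗[A] Q) ≃ₗ[T] T ⊗[B] (M ⊗[A] Q) :=
  AlgebraTensorModule.cancelBaseChange A R T (T ⊗[B] M) Q ≪≫ₗ
    AlgebraTensorModule.assoc A B T T M Q

theorem tensorBaseChangeEquiv_tmul {Q : Type*} [AddCommGroup Q] [Module A Q] (b : T) (n : M)
    (r : R) (z : Q) :
    tensorBaseChangeEquiv (A := A) (R := R) Q ((b ⊗ₜ[B] n) ⊗ₜ[R] (r ⊗ₜ[A] z)) =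
      (algebraMap R T r * b) ⊗ₜ[B] (n ⊗ₜ[A] z) := by
  simp [tensorBaseChangeEquiv, TensorProduct.smul_tmul', Algebra.smul_def]

/-- Turns a purity test over `R` into ideal membership in `T`: the tensor product is moved to `T ⊗_B
(M ⊗_A Q)` modulo `J`, where flatness of `T ⧸ JT` over `B` computes the annihilator. -/
theorem smul_tmul_mkQ_eq_zero_iff {J : Ideal R} [Module.Flat B (T ⧸ J.map (algebraMap R T))]
    {Q : Type*} [AddCommGroup Q] [Module A Q] (n : M) (z : Q) (b : T) (r : R) :
    (b • ((1 : T) ⊗ₜ[B] n)) ⊗ₜ[R] ((J • ⊤ : Submodule R (R ⊗[A] Q)).mkQ (r ⊗ₜ z)) = 0 ↔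
      b * algebraMap R T r ∈ (Ideal.torsionOf B (M ⊗[A] Q) (n ⊗ₜ z)).map (algebraMap B T) ⊔
        J.map (algebraMap R T) := by
  let X : (T ⊗[B] M) ⊗[R] (R ⊗[A] Q) := (b • ((1 : T) ⊗ₜ[B] n)) ⊗ₜ[R] (r ⊗ₜ z)
  let e := tensorBaseChangeEquiv (A := A) (R := R) (B := B) (T := T) (M := M) Q
  have heX : e X = (b * algebraMap R T r) ⊗ₜ (n ⊗ₜ z) := by
    rw [mul_comm, ← tensorBaseChangeEquiv_tmul]
    simp only [e, X, TensorProduct.smul_tmul', smul_eq_mul, mul_one]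
  rw [← tmul_mem_smul_top_iff, ← heX]
  refine (lTensor_mkQ_eq_zero_iff (T := T) (J := J) X).trans ⟨fun h => ?_, fun h => ?_⟩
  · have h1 := Submodule.mem_map_of_mem (f := e.toLinearMap) h
    rw [Submodule.map_smul'', LinearEquiv.coe_toLinearMap] at h1
    exact Submodule.smul_mono le_rfl le_top h1
  · have h1 := Submodule.mem_map_of_mem (f := e.symm.toLinearMap) h
    rw [Submodule.map_smul'', LinearEquiv.coe_toLinearMap, e.symm_apply_apply] at h1
    exact Submodule.smul_mono le_rfl le_top h1

variable [IsLocalRing A] [IsNoetherianRing A] [IsLocalRing R] [IsNoetherianRing R]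
  [IsLocalHom (algebraMap A R)] [Module.Flat A R] [IsNoetherianRing B] [IsNoetherianRing T]

open RingTheory.Sequence in
theorem flat_quotient_ofList_pow {l : List R} (hl : ∀ y ∈ l, y ∈ maximalIdeal R)
    (hreg : IsWeaklyRegular (R ⊗[A] (A ⧸ maximalIdeal A)) l) (t : ℕ) :
    Module.Flat A (R ⧸ Ideal.ofList (l.map (· ^ (t + 1)))) := by
  have := finite_tensor (A := A) (R := R) (S := R) (A ⧸ maximalIdeal A)
  have h1 := isWeaklyRegular_pow_append t l [] (by simpa using hl) (by simpa using hreg)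
  rw [List.append_nil] at h1
  have h2 := (isWeaklyRegular_tensor_and_flat.{0} _ h1).2
  rwa [smul_eq_mul, Ideal.mul_top] at h2

open RingTheory.Sequence in
/-- The impurity ideal under a flat local base change `A → R` whose closed fibre has a regular
sequence `l` generating its maximal ideal. -/
theorem impurityIdeal_baseChange (n : M) (l : List R) (hl : ∀ y ∈ l, y ∈ maximalIdeal R)
    (hreg : IsWeaklyRegular (R ⊗[A] (A ⧸ maximalIdeal A)) l)
    (hmax : (maximalIdeal A).map (algebraMap A R) ⊔ Ideal.ofList l = maximalIdeal R)
    (hflat : ∀ t : ℕ, Module.Flat B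
      (T ⧸ (Ideal.ofList (l.map (· ^ (t + 1)))).map (algebraMap R T)))
    (hcolon : ∀ (I : Ideal B) (t : ℕ) (b : T),
      b * algebraMap R T (l.prod ^ t) ∈ I.map (algebraMap B T) ⊔
        (Ideal.ofList (l.map (· ^ (t + 1)))).map (algebraMap R T) →
      b ∈ I.map (algebraMap B T) ⊔ (Ideal.ofList l).map (algebraMap R T)) :
    impurityIdeal R T ((1 : T) ⊗ₜ[B] n) =
      (impurityIdeal A B n).map (algebraMap B T) ⊔ (Ideal.ofList l).map (algebraMap R T) := by
  have hflatR := flat_quotient_ofList_pow hl hreg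
  have hone : l.map (· ^ (0 + 1)) = l := by simp
  refine le_antisymm (fun b hb => ?_) fun b hb => ?_
  · obtain ⟨Q', _, _, _, z', j, hz', hj, hb'⟩ :=
      exists_of_not_isPureMap (not_isPureMap_of_mem_impurityIdeal hb)
    have hmle : (maximalIdeal A).map (algebraMap A R) ≤ maximalIdeal R := hmax ▸ le_sup_left
    -- The exponent is `j + 1` rather than `j` so that the ideal is proper when `j = 0`.
    have hN : maximalIdeal A ^ (j + 1) ≤ maximalIdeal A := Ideal.pow_le_self j.succ_ne_zero
    obtain ⟨Q, _, _, _, z, hz, hann⟩ := IsSocleGenerator.exists_annihilator_eq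
      (maximalIdeal A ^ (j + 1)) hN (isFiniteLength_quotient_of_pow_le le_rfl)
    let J : Ideal R := Ideal.ofList (l.map (· ^ (j + 1)))
    have hfl := hflatR j
    have hflT := hflat j
    have hfl0 := hflatR 0
    rw [hone] at hfl0
    have hfin := finite_tensor (A := A) (R := R) (S := R) Q
    -- A test module over `R` built from `Q`: simple socle modulo `(l)`, then exponents raised to `j
    -- + 1`. It is faithful over the quotient of `R` by `𝔪 ^ (j + 1) R + J`.
    have hP : IsSocleGenerator R ((J • ⊤ : Submodule R (R ⊗[A] Q)).mkQ (l.prod ^ j • 1 ⊗ₜ z)) := by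
      have := isSocleGenerator_pow_append (C := R ⊗[A] Q) (u := 1 ⊗ₜ z) j l []
        (by simpa using hl)
        (by simpa using (isWeaklyRegular_tensor_and_flat l hreg).1 Q)
        (by rw [List.append_nil]; exact isSocleGenerator_mkQ_one_tmul hmax hz hann.ge)
      rwa [List.append_nil] at this
    have hannP := annihilator_quotient_smul_top (A := A) (J := J) Q
    rw [hann] at hannP
    -- Both `𝔪 ^ (j + 1) R` and `J` lie in the power `j + 1` of the maximal ideal of `R`, which
    -- kills `Q'`. The lift puts `Q'` in the universe of `R ⊗[A] Q`, as `exists_embedding` requires.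
    have hJ' : (maximalIdeal A ^ (j + 1)).map (algebraMap A R) ⊔ J ≤
        Module.annihilator R (ULift.{u} Q') := by
      rw [(ULift.moduleEquiv (R := R) (M := Q')).annihilator_eq]
      refine le_trans ?_ hj
      refine le_trans (sup_le ?_ ?_) (Ideal.pow_le_pow_right j.le_succ)
      · rw [Ideal.map_pow]
        exact Ideal.pow_right_mono hmle _
      · refine Ideal.span_le.2 fun y hy => ?_
        obtain ⟨x, hx, rfl⟩ := List.mem_map.1 hy
        exact Ideal.pow_mem_pow (hl x hx) _
    have hfinJ : IsFiniteLength R (R ⧸ (maximalIdeal A ^ (j + 1)).map (algebraMap A R) ⊔ J) := by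
      have hrad : maximalIdeal R ≤
          ((maximalIdeal A ^ (j + 1)).map (algebraMap A R) ⊔ J).radical := by
        rw [← hmax]
        refine sup_le (Ideal.map_le_iff_le_comap.2 fun a ha => ⟨j + 1, ?_⟩)
          (Ideal.span_le.2 fun y hy => ⟨j + 1, ?_⟩)
        · rw [← map_pow]
          exact Ideal.mem_sup_left (Ideal.mem_map_of_mem _ (Ideal.pow_mem_pow ha _))
        · exact Ideal.mem_sup_right (Ideal.subset_span (List.mem_map.2 ⟨y, hy, rfl⟩))
      obtain ⟨k, hk⟩ := Ideal.exists_pow_le_of_le_radical_of_fg hrad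
        (maximalIdeal R).fg_of_isNoetherianRing
      exact isFiniteLength_quotient_of_pow_le hk
    obtain ⟨i, hi⟩ := IsSocleGenerator.exists_embedding hP
      (hz'.map_equiv (ULift.moduleEquiv (R := R) (M := Q')).symm) hannP hJ' hfinJ
    -- The vanishing against `z'` is pushed along the embedding `i` to the explicit socle generator.
    have h0 : (b • ((1 : T) ⊗ₜ[B] n)) ⊗ₜ[R]
        ((J • ⊤ : Submodule R (R ⊗[A] Q)).mkQ ((l.prod ^ j) ⊗ₜ z)) = 0 := by
      have h1 : (l.prod ^ j) ⊗ₜ[A] z = l.prod ^ j • (1 : R) ⊗ₜ[A] z := by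
        rw [TensorProduct.smul_tmul', smul_eq_mul, mul_one]
      rw [h1, ← hi, ← LinearEquiv.coe_toLinearMap, ← LinearMap.comp_apply,
        ← LinearMap.lTensor_tmul, hb', map_zero]
    rw [smul_tmul_mkQ_eq_zero_iff] at h0
    have hle : (Ideal.torsionOf B (M ⊗[A] Q) (n ⊗ₜ z)).map (algebraMap B T) ≤
        (impurityIdeal A B n).map (algebraMap B T) :=
      Ideal.map_mono (torsionOf_tmul_le_impurityIdeal n hz.1)
    exact hcolon _ j b ((sup_le_sup hle le_rfl) h0)
  -- Conversely, one `Q` computes the whole ideal over `A`, and its base change modulo `(l)` is a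
  -- test module over `R` whose annihilator is the right-hand side.
  · obtain ⟨Q, _, _, _, z, j, hz, hj, hI⟩ := exists_torsionOf_eq_impurityIdeal (A := A) (B := B) n
    have h0 := hflat 0
    have h0' := hflatR 0
    rw [hone] at h0 h0'
    have hs := isSocleGenerator_mkQ_one_tmul hmax hz hj
    refine torsionOf_tmul_le_impurityIdeal _ hs.1 ?_
    rw [Ideal.mem_torsionOf_iff, TensorProduct.smul_tmul', smul_tmul_mkQ_eq_zero_iff, map_one,
      mul_one, hI]
    exact hb

end BaseChange

/-! ### Regular systems of parameters are regular sequences -/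

section RegularLocalRing

open RingTheory.Sequence

theorem ringKrullDim_le_of_span_range_eq {R : Type*} [CommRing R] [IsLocalRing R]
    [IsNoetherianRing R] {d : ℕ} (x : Fin d → R) (hx : Ideal.span (Set.range x) = maximalIdeal R) :
    ringKrullDim R ≤ d := by
  refine (ringKrullDim_le_spanFinrank_maximalIdeal R).trans ?_
  have h1 : (maximalIdeal R).spanFinrank ≤ (Set.range x).ncard :=
    hx ▸ Submodule.spanFinrank_span_le_ncard_of_finite (Set.finite_range x)
  have h2 : (Set.range x).ncard ≤ d := by
    rw [← Set.image_univ]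
    exact (Set.ncard_image_le Set.finite_univ).trans (by simp)
  exact_mod_cast h1.trans h2

theorem le_ringKrullDim_quotient {R : Type*} [CommRing R] [IsLocalRing R] [IsNoetherianRing R]
    {d : ℕ} (hd : ringKrullDim R = (d + 1 : ℕ)) {y : R} (hy : y ∈ maximalIdeal R) :
    d ≤ ringKrullDim (R ⧸ Ideal.span {y}) := by
  have h := Ideal.height_le_ringKrullDim_quotient_add_one hy
  rw [maximalIdeal_height_eq_ringKrullDim, hd, Nat.cast_succ] at h
  exact ENat.WithBot.add_le_add_one_right_iff.1 h

/-- A Noetherian local ring whose maximal ideal is generated by `dim R` elements is a domain. -/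
theorem isDomain_of_span_range_eq_maximalIdeal (d : ℕ) :
    ∀ {R : Type*} [CommRing R] [IsLocalRing R] [IsNoetherianRing R] (x : Fin d → R),
      Ideal.span (Set.range x) = maximalIdeal R → ringKrullDim R = d → IsDomain R := by
  induction d with
  | zero =>
    intro R _ _ _ x hx _
    rw [Set.range_eq_empty, Ideal.span_empty] at hx
    exact (isField_iff_maximalIdeal_eq.2 hx.symm).isDomain
  | succ d ih =>
    intro R _ _ _ x hx hdim
    have hht : ((maximalIdeal R).height : WithBot ℕ∞) = (d + 1 : ℕ) := by
      rw [maximalIdeal_height_eq_ringKrullDim, hdim]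
    have hfin := minimalPrimes.finite_of_isNoetherianRing R
    -- an element outside the square of the maximal ideal and outside the minimal primes
    obtain ⟨y, hy, hy2, hymin⟩ : ∃ y ∈ maximalIdeal R, y ∉ maximalIdeal R ^ 2 ∧
        ∀ P ∈ minimalPrimes R, y ∉ P := by
      by_contra hcon
      push Not at hcon
      classical
      have hsub : (maximalIdeal R : Set R) ⊆
          ⋃ i ∈ (↑(insert (maximalIdeal R ^ 2) hfin.toFinset) : Set (Ideal R)), (id i : Ideal R) := by
        intro y hy
        by_cases hy2 : y ∈ maximalIdeal R ^ 2
        · exact Set.mem_biUnion (by simp) hy2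
        · obtain ⟨P, hP, hyP⟩ := hcon y hy hy2
          exact Set.mem_biUnion (x := P) (by simp [hP]) hyP
      obtain ⟨I, hI, hle⟩ := (Ideal.subset_union_prime (maximalIdeal R ^ 2) (maximalIdeal R ^ 2)
        (fun i hi hne _ => by
          rw [Finset.mem_insert] at hi
          exact Ideal.IsMinimalPrime.isPrime (hfin.mem_toFinset.1 (hi.resolve_left hne)))).1 hsub
      rw [Finset.mem_insert] at hI
      rcases hI with rfl | hI
      · have hbot : maximalIdeal R = ⊥ := Submodule.eq_bot_of_le_smul_of_le_jacobson_bot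
          (maximalIdeal R) (maximalIdeal R) (maximalIdeal R).fg_of_isNoetherianRing
          (by rw [smul_eq_mul, ← pow_two]; exact hle) (maximalIdeal_le_jacobson _)
        have := ringKrullDim_eq_zero_of_isField (isField_iff_maximalIdeal_eq.2 hbot)
        rw [hdim] at this
        exact absurd this (by exact_mod_cast d.succ_ne_zero)
      · have hmem := hfin.mem_toFinset.1 hI
        have hprime := Ideal.IsMinimalPrime.isPrime hmem
        have heq : I = maximalIdeal R := le_antisymm (le_maximalIdeal hprime.ne_top) hle
        rw [heq] at hmem
        have h0 : (maximalIdeal R).height = 0 := Ideal.height_eq_zero_iff.2 hmem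
        rw [h0] at hht
        exact absurd hht (by exact_mod_cast d.succ_ne_zero.symm)
    have hnt : Nontrivial (R ⧸ Ideal.span {y}) := Ideal.Quotient.nontrivial_iff.2 fun h =>
      (maximalIdeal.isMaximal R).ne_top (top_le_iff.1 (h ▸ (Ideal.span_singleton_le_iff_mem _).2 hy))
    have : IsLocalRing (R ⧸ Ideal.span {y}) :=
      IsLocalRing.of_surjective' (Ideal.Quotient.mk _) Ideal.Quotient.mk_surjective
    obtain ⟨c, hc⟩ := Ideal.mem_span_range_iff_exists_fun.1 (hx ▸ hy)
    -- As `y` is not in the square of the maximal ideal, some coefficient `c i` is a unit, so `x i`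
    -- becomes redundant modulo `y` and `d` generators remain.
    obtain ⟨i, hi⟩ : ∃ i, IsUnit (c i) := by
      by_contra hcon
      push Not at hcon
      refine hy2 (hc ▸ Ideal.sum_mem _ fun i _ => ?_)
      rw [pow_two]
      exact Ideal.mul_mem_mul (hcon i) (hx ▸ Ideal.subset_span ⟨i, rfl⟩)
    let π := Ideal.Quotient.mk (Ideal.span {y})
    have hspan : Ideal.span (Set.range fun j : Fin d => π (x (i.succAbove j))) =
        maximalIdeal (R ⧸ Ideal.span {y}) := by
      rw [← map_maximalIdeal_of_surjective π Ideal.Quotient.mk_surjective, ← hx, Ideal.map_span]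
      refine le_antisymm (Ideal.span_mono ?_) (Ideal.span_le.2 ?_)
      · rintro _ ⟨j, rfl⟩
        exact ⟨_, ⟨_, rfl⟩, rfl⟩
      · rintro _ ⟨_, ⟨k, rfl⟩, rfl⟩
        rcases eq_or_ne k i with rfl | hk
        · obtain ⟨b, hb⟩ := hi.exists_left_inv
          have h0 : π (∑ i, c i * x i) = 0 :=
            Ideal.Quotient.eq_zero_iff_mem.2 (hc ▸ Ideal.mem_span_singleton_self y)
          rw [Fin.sum_univ_succAbove _ k, map_add, map_sum] at h0
          have h1 : π (x k) = π b * (π (c k * x k)) := by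
            rw [← map_mul, ← mul_assoc, hb, one_mul]
          rw [h1, eq_neg_of_add_eq_zero_left h0]
          refine Ideal.mul_mem_left _ _ (neg_mem (Ideal.sum_mem _ fun j _ => ?_))
          rw [map_mul]
          exact Ideal.mul_mem_left _ _ (Ideal.subset_span ⟨j, rfl⟩)
        · obtain ⟨j, rfl⟩ := Fin.exists_succAbove_eq hk
          exact Ideal.subset_span ⟨j, rfl⟩
    have hdom := ih _ hspan
      (le_antisymm (ringKrullDim_le_of_span_range_eq _ hspan) (le_ringKrullDim_quotient hdim hy))
    have hprime : (Ideal.span {y}).IsPrime := (Ideal.Quotient.isDomain_iff_prime _).1 hdom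
    -- A minimal prime `P` inside the prime `(y)` does not contain `y`, so `P = yP`, and Nakayama's
    -- lemma gives `P = 0`.
    obtain ⟨P, hP, hPy⟩ := Ideal.exists_minimalPrimes_le (I := ⊥) (J := Ideal.span {y}) bot_le
    have hPp : P.IsPrime := Ideal.IsMinimalPrime.isPrime hP
    have hPbot : P = ⊥ := by
      refine Submodule.eq_bot_of_le_smul_of_le_jacobson_bot (maximalIdeal R) P
        P.fg_of_isNoetherianRing (fun a ha => ?_) (maximalIdeal_le_jacobson _)
      obtain ⟨r, rfl⟩ := Ideal.mem_span_singleton'.1 (hPy ha)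
      rw [mul_comm]
      exact Submodule.smul_mem_smul hy ((hPp.mem_or_mem ha).resolve_right (hymin P hP))
    rw [hPbot] at hPp
    exact IsDomain.of_bot_isPrime R

theorem ofList_eq_span_range_get {R : Type*} [CommRing R] (l : List R) :
    Ideal.ofList l = Ideal.span (Set.range l.get) := by
  rw [Set.range_list_get]

/-- In a Noetherian local ring, `dim R` generators of the maximal ideal form a regular sequence. -/
theorem isWeaklyRegular_of_ofList_eq_maximalIdeal (d : ℕ) :
    ∀ {R : Type*} [CommRing R] [IsLocalRing R] [IsNoetherianRing R] (l : List R),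
      l.length = d → Ideal.ofList l = maximalIdeal R → ringKrullDim R = d →
      IsWeaklyRegular R l := by
  induction d with
  | zero =>
    intro R _ _ _ l hl _ _
    rw [List.length_eq_zero_iff.1 hl]
    exact .nil R R
  | succ d ih =>
    intro R _ _ _ l hl hspan hdim
    obtain ⟨y, l, rfl⟩ := List.exists_cons_of_length_eq_add_one hl
    have hlen : l.length = d := by simpa using hl
    have : IsDomain R := isDomain_of_span_range_eq_maximalIdeal _ (y :: l).get
      (by rw [← ofList_eq_span_range_get, hspan]) (by rw [hdim, hl])
    have hy : y ∈ maximalIdeal R := hspan ▸ Ideal.subset_span (by simp)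
    have hy0 : y ≠ 0 := by
      rintro rfl
      rw [Ideal.ofList_cons, Ideal.span_singleton_eq_bot.2 rfl, bot_sup_eq,
        ofList_eq_span_range_get] at hspan
      have := ringKrullDim_le_of_span_range_eq _ hspan
      rw [hdim, hlen] at this
      exact absurd this (by exact_mod_cast d.lt_succ_self.not_ge)
    have hnt : Nontrivial (R ⧸ Ideal.span {y}) := Ideal.Quotient.nontrivial_iff.2 fun h =>
      (maximalIdeal.isMaximal R).ne_top (top_le_iff.1 (h ▸ (Ideal.span_singleton_le_iff_mem _).2 hy))
    have : IsLocalRing (R ⧸ Ideal.span {y}) :=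
      IsLocalRing.of_surjective' (Ideal.Quotient.mk _) Ideal.Quotient.mk_surjective
    have hspan' : Ideal.ofList (l.map (Ideal.Quotient.mk (Ideal.span {y}))) =
        maximalIdeal (R ⧸ Ideal.span {y}) := by
      rw [← map_maximalIdeal_of_surjective (Ideal.Quotient.mk (Ideal.span {y}))
        Ideal.Quotient.mk_surjective, ← hspan, ← Ideal.map_ofList, Ideal.ofList_cons,
        Ideal.map_sup, Ideal.map_quotient_self, bot_sup_eq]
    have hdim' : ringKrullDim (R ⧸ Ideal.span {y}) = d := by
      refine le_antisymm ?_ (le_ringKrullDim_quotient hdim hy)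
      have := ringKrullDim_le_of_span_range_eq _ ((ofList_eq_span_range_get _).symm.trans hspan')
      rwa [List.length_map, hlen] at this
    have h := ih (l.map (Ideal.Quotient.mk (Ideal.span {y}))) (by simpa using hlen) hspan' hdim'
    rw [isWeaklyRegular_cons_iff]
    refine ⟨(IsRegular.of_ne_zero hy0).left, ?_⟩
    have h' : IsWeaklyRegular (R ⧸ Ideal.span {y}) l :=
      (isWeaklyRegular_map_algebraMap_iff (R ⧸ Ideal.span {y}) (R ⧸ Ideal.span {y}) l).1 h
    refine (LinearEquiv.isWeaklyRegular_congr (Submodule.quotEquivOfEq _ _ ?_) l).1 h'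
    rw [← Submodule.ideal_span_singleton_smul, smul_eq_mul, Ideal.mul_top]

end RegularLocalRing

/-! ### Normal domains and their height one primes -/

section HeightOne

variable {R : Type*} [CommRing R] [IsDomain R] [IsNoetherianRing R] [IsIntegrallyClosed R]

/-- In a Noetherian normal domain, the primes associated to a nonzero principal ideal have height
one. -/
theorem height_eq_one_of_forall_mem_iff {b c : R} (hb : b ≠ 0) {q : Ideal R} [q.IsPrime]
    (hq : ∀ r, r ∈ q ↔ b ∣ r * c) : q.height = 1 := by
  have hbq : b ∈ q := (hq b).2 (dvd_mul_right b c)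
  have hc : ¬ b ∣ c := fun h => Ideal.IsPrime.one_notMem ‹_› ((hq 1).2 (by rwa [one_mul]))
  have hqbot : q ≠ ⊥ := fun h => hb (by simpa [h] using hbq)
  -- Otherwise `c / b` maps the finite module `q` into itself, so it is integral over `R`, hence
  -- lies in `R`, contradicting `b ∤ c`.
  obtain ⟨t, ht, u, hu, htu⟩ : ∃ t ∈ q, ∃ u ∉ q, t * c = b * u := by
    by_contra! hcon
    have hbK : algebraMap R (FractionRing R) b ≠ 0 := by simpa using hb
    set z : FractionRing R := algebraMap R _ c / algebraMap R _ b with hz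
    set N : Submodule R (FractionRing R) := Submodule.map (Algebra.linearMap R _) q with hN
    have hintegral : IsIntegral R z := by
      refine isIntegral_of_smul_mem_submodule (N := N) (fun h => hbK ?_)
        (Submodule.FG.map _ q.fg_of_isNoetherianRing) z ?_
      · have : algebraMap R (FractionRing R) b ∈ N := ⟨b, hbq, rfl⟩
        rwa [h, Submodule.mem_bot] at this
      · rintro _ ⟨s, hs, rfl⟩
        obtain ⟨u, hu⟩ := (hq s).1 hs
        refine ⟨u, not_not.1 fun h => hcon s hs u h hu, ?_⟩
        rw [Algebra.linearMap_apply, Algebra.linearMap_apply, smul_eq_mul, hz, div_mul_eq_mul_div,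
          eq_div_iff hbK, ← map_mul, ← map_mul, mul_comm u, ← hu, mul_comm]
    obtain ⟨y, hy⟩ := IsIntegrallyClosed.isIntegral_iff.1 hintegral
    refine hc ⟨y, IsFractionRing.injective R (FractionRing R) ?_⟩
    rw [map_mul, hy, hz, mul_div_cancel₀ _ hbK]
  -- For `s ∈ q`, comparing `s c ∈ bR` with `t c = b u` gives `s u ∈ tR`. A prime inside `q` that
  -- contains `t` therefore contains `s`, since `u ∉ q`.
  have hmin : q ∈ (Ideal.span {t}).minimalPrimes := by
    refine ⟨⟨‹_›, by simpa [Ideal.span_le] using ht⟩, fun P ⟨hP, hPt⟩ hPq s hs => ?_⟩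
    obtain ⟨s', hs'⟩ := (hq s).1 hs
    have hsu : s * u = s' * t := mul_left_cancel₀ hb (by linear_combination t * hs' - s * htu)
    refine (hP.mem_or_mem (?_ : s * u ∈ P)).resolve_right fun h => hu (hPq h)
    rw [hsu]
    exact P.mul_mem_left _ (hPt (Ideal.mem_span_singleton_self t))
  refine le_antisymm (Ideal.height_le_one_of_isPrincipal_of_mem_minimalPrimes _ q hmin) ?_
  rw [Order.one_le_iff_ne_zero, Ne, Ideal.height_eq_zero_iff_eq_bot]
  exact hqbot

theorem HeightOnePrime.exists_smul_eq_of_valuation_le_one (Q : HeightOnePrime R)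
    {z : FractionRing R} (hz : Q.valuation z ≤ 1) :
    ∃ s ∉ Q.1.asIdeal, ∃ r : R, algebraMap R (FractionRing R) s * z = algebraMap R _ r := by
  obtain ⟨y, rfl⟩ := IsDiscreteValuationRing.exists_lift_of_le_one hz
  obtain ⟨⟨r, s⟩, hs⟩ := IsLocalization.surj Q.1.asIdeal.primeCompl y
  refine ⟨s, s.2, r, ?_⟩
  have := congrArg (algebraMap Q.localRing (FractionRing R)) hs
  rw [map_mul, ← IsScalarTower.algebraMap_apply, ← IsScalarTower.algebraMap_apply] at this
  rw [mul_comm, this]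

/-- A Noetherian normal domain is the intersection of its localizations at height one primes. -/
theorem mem_range_algebraMap_of_valuation_le_one {z : FractionRing R}
    (hz : ∀ Q : HeightOnePrime R, Q.valuation z ≤ 1) : z ∈ (algebraMap R (FractionRing R)).range := by
  obtain ⟨a, b, hb, rfl⟩ := IsFractionRing.div_surjective (A := R) z
  have hb0 : b ≠ 0 := nonZeroDivisors.ne_zero hb
  have hbK : algebraMap R (FractionRing R) b ≠ 0 := by simpa using hb0
  by_contra hcon
  have ha : Ideal.Quotient.mk (Ideal.span {b}) a ≠ 0 := by
    rw [Ne, Ideal.Quotient.eq_zero_iff_mem, Ideal.mem_span_singleton]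
    rintro ⟨y, rfl⟩
    exact hcon ⟨y, by rw [map_mul, mul_div_cancel_left₀ _ hbK]⟩
  -- An associated prime of `R ⧸ b` containing the annihilator of the class of `a`. It has height
  -- one, and integrality of `a / b` at `q` gives `s ∉ q` with `s a ∈ bR`, that is, `s` in that
  -- annihilator.
  obtain ⟨q, hqass, hq⟩ := exists_le_isAssociatedPrime_of_isNoetherianRing (R := R) _ ha
  obtain ⟨hqp, c, hqc⟩ := isAssociatedPrime_iff.1 hqass
  obtain ⟨c, rfl⟩ := Ideal.Quotient.mk_surjective c
  have hmem : ∀ x r : R, r ∈ (⊥ : Submodule R (R ⧸ Ideal.span {b})).colon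
      {Ideal.Quotient.mk (Ideal.span {b}) x} ↔ b ∣ r * x := by
    intro x r
    rw [Submodule.mem_colon_singleton, Submodule.mem_bot, Algebra.smul_def,
      Ideal.Quotient.algebraMap_eq, ← map_mul, Ideal.Quotient.eq_zero_iff_mem,
      Ideal.mem_span_singleton]
  have hht : q.height = 1 := height_eq_one_of_forall_mem_iff hb0 (c := c) fun r => by
    rw [hqc, hmem]
  obtain ⟨s, hs, r, hr⟩ :=
    HeightOnePrime.exists_smul_eq_of_valuation_le_one ⟨⟨q, hqp⟩, hht⟩ (hz ⟨⟨q, hqp⟩, hht⟩)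
  refine hs (hq ((hmem a s).2 ⟨r, IsFractionRing.injective R (FractionRing R) ?_⟩))
  rw [map_mul, map_mul, ← hr]
  field_simp

/-- The valuation at `Q` of a generator of the `n`-th power of the maximal ideal of `R_Q`. -/
theorem HeightOnePrime.valuation_irreducible_pow (Q : HeightOnePrime R) {ϖ : Q.localRing}
    (hϖ : Irreducible ϖ) (n : ℕ) :
    Q.valuation (algebraMap Q.localRing (FractionRing R) (ϖ ^ n)) = WithZero.exp (-n : ℤ) := by
  have h := Ring.ordFrac_irreducible (K := FractionRing R) hϖ
  rw [Ring.ordFrac_eq_valuation_inv, inv_eq_iff_eq_inv] at h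
  rw [map_pow, map_pow, HeightOnePrime.valuation, h, ← WithZero.exp_neg, ← WithZero.exp_nsmul]
  simp

/-- Locally `J` is generated by `ϖ ^ n`, so both sides say that `z ϖ ^ n` is integral at `Q`. -/
theorem HeightOnePrime.valuation_le_exp_iff (Q : HeightOnePrime R) {J : Ideal R} {n : ℕ}
    (hJ : J.map (algebraMap R Q.localRing) = maximalIdeal Q.localRing ^ n) (z : FractionRing R) :
    Q.valuation z ≤ WithZero.exp (n : ℤ) ↔
      ∀ j ∈ J, Q.valuation (z * algebraMap R (FractionRing R) j) ≤ 1 := by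
  obtain ⟨ϖ, hϖ⟩ := IsDiscreteValuationRing.exists_irreducible Q.localRing
  have hspan : J.map (algebraMap R Q.localRing) = Ideal.span {ϖ ^ n} := by
    rw [hJ, hϖ.maximalIdeal_eq, Ideal.span_singleton_pow]
  have hintegral : ∀ y : Q.localRing, Q.valuation (algebraMap Q.localRing (FractionRing R) y) ≤ 1 :=
    fun y => IsDedekindDomain.HeightOneSpectrum.valuation_le_one _ _
  have hval := Q.valuation_irreducible_pow hϖ n
  have hexp : WithZero.exp (n : ℤ) * WithZero.exp (-n : ℤ) = 1 := by
    rw [← WithZero.exp_add, add_neg_cancel, WithZero.exp_zero]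
  constructor
  · intro hz j hj
    have hj' : algebraMap R Q.localRing j ∈ Ideal.span {ϖ ^ n} :=
      hspan ▸ Ideal.mem_map_of_mem _ hj
    obtain ⟨y, hy⟩ := Ideal.mem_span_singleton.1 hj'
    rw [IsScalarTower.algebraMap_apply R Q.localRing (FractionRing R), hy, map_mul, map_mul,
      map_mul, hval, ← mul_assoc]
    calc _ ≤ WithZero.exp (n : ℤ) * WithZero.exp (-n : ℤ) * 1 := by
          gcongr
          exact hintegral y
      _ = 1 := by rw [hexp, mul_one]
  · intro h
    have key : ∀ y ∈ J.map (algebraMap R Q.localRing),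
        Q.valuation (z * algebraMap Q.localRing (FractionRing R) y) ≤ 1 := by
      intro y hy
      induction hy using Submodule.span_induction with
      | mem y hy =>
        obtain ⟨j, hj, rfl⟩ := hy
        rw [← IsScalarTower.algebraMap_apply]
        exact h j hj
      | zero => simp
      | add x y _ _ hx hy =>
        rw [map_add, mul_add]
        exact Valuation.map_add_le _ hx hy
      | smul a y _ hy =>
        rw [smul_eq_mul, map_mul (algebraMap Q.localRing (FractionRing R)), mul_left_comm, map_mul]
        exact mul_le_one' (hintegral a) hy
    have h1 := key (ϖ ^ n) (hspan ▸ Ideal.mem_span_singleton_self _)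
    rw [map_mul, hval] at h1
    calc Q.valuation z = Q.valuation z * WithZero.exp (-n : ℤ) * WithZero.exp (n : ℤ) := by
          rw [mul_assoc, mul_comm (WithZero.exp (-n : ℤ)), hexp, mul_one]
      _ ≤ 1 * WithZero.exp (n : ℤ) := by gcongr
      _ = _ := one_mul _

/-- Only the localizations of `J` at height one primes matter, so `J` need not be divisorial. This
lets `∏ P ^ n_P` and its extension to `R` serve on the two sides of the base change. -/
theorem WeilDivisor.mem_sections_iff {E : WeilDivisor R} (hE : 0 ≤ E) {J : Ideal R}
    (hJ : ∀ Q : HeightOnePrime R,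
      J.map (algebraMap R Q.localRing) = maximalIdeal Q.localRing ^ (E Q).toNat)
    (z : FractionRing R) :
    z ∈ E.sections ↔ ∀ j ∈ J,
      z * algebraMap R (FractionRing R) j ∈ (algebraMap R (FractionRing R)).range := by
  have h : ∀ Q, Q.valuation z ≤ WithZero.exp (E Q) ↔
      ∀ j ∈ J, Q.valuation (z * algebraMap R (FractionRing R) j) ≤ 1 := fun Q => by
    rw [← Q.valuation_le_exp_iff (hJ Q), Int.toNat_of_nonneg (hE Q)]
  refine ⟨fun hz j hj => mem_range_algebraMap_of_valuation_le_one fun Q => (h Q).1 (hz Q) j hj,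
    fun hz Q => (h Q).2 fun j hj => ?_⟩
  obtain ⟨r, hr⟩ := hz j hj
  rw [← hr]
  exact Q.valuation_algebraMap_le_one r

end HeightOne

/-! ### The ideal of an effective divisor and its pullback -/

section DivisorIdeal

/-- The product of the powers `P ^ n_P` attached to an effective divisor `∑ n_P P`. -/
def WeilDivisor.ideal {A : Type*} [CommRing A] (D : WeilDivisor A) : Ideal A :=
  ∏ P ∈ D.support, P.1.asIdeal ^ (D P).toNat

theorem WeilDivisor.ideal_ne_bot {A : Type*} [CommRing A] [IsDomain A] (D : WeilDivisor A) :
    D.ideal ≠ ⊥ := by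
  rw [WeilDivisor.ideal, Ne, ← Ideal.zero_eq_bot, Finset.prod_eq_zero_iff]
  rintro ⟨P, -, hP⟩
  exact Ideal.ne_bot_of_height_eq_one P.2 (eq_zero_of_pow_eq_zero hP)

theorem WeilDivisor.map_ideal {A S : Type*} [CommRing A] [CommRing S] (D : WeilDivisor A)
    (φ : A →+* S) : D.ideal.map φ = ∏ P ∈ D.support, P.1.asIdeal.map φ ^ (D P).toNat := by
  rw [WeilDivisor.ideal, ← Ideal.mapHom_apply, map_prod]
  simp [Ideal.map_pow]

theorem WeilDivisor.map_ideal_eq_top {A S : Type*} [CommRing A] [CommRing S] (D : WeilDivisor A)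
    (φ : A →+* S) (h : ∀ P : HeightOnePrime A, P.1.asIdeal.map φ = ⊤) : D.ideal.map φ = ⊤ := by
  rw [D.map_ideal, ← Ideal.one_eq_top]
  exact Finset.prod_eq_one fun P _ => by rw [h P, ← Ideal.one_eq_top, one_pow]

theorem WeilDivisor.map_ideal_eq_pow {A S : Type*} [CommRing A] [CommRing S] (D : WeilDivisor A)
    (φ : A →+* S) (P : HeightOnePrime A)
    (h : ∀ P' : HeightOnePrime A, P' ≠ P → P'.1.asIdeal.map φ = ⊤) :
    D.ideal.map φ = P.1.asIdeal.map φ ^ (D P).toNat := by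
  rw [D.map_ideal]
  refine Finset.prod_eq_single P (fun P' _ hP' => ?_) fun hP => ?_
  · rw [h P' hP', ← Ideal.one_eq_top, one_pow]
  · rw [Finsupp.notMem_support_iff.1 hP, Int.toNat_zero, pow_zero]

theorem map_eq_top_of_not_le_under {A R : Type*} [CommRing A] [CommRing R] [Algebra A R]
    {q : Ideal R} [q.IsPrime] {I : Ideal A} (hI : ¬ I ≤ q.under A) :
    I.map (algebraMap A (Localization.AtPrime q)) = ⊤ := by
  obtain ⟨a, ha, haq⟩ := SetLike.not_le_iff_exists.1 hI
  refine Ideal.eq_top_of_isUnit_mem _ (Ideal.mem_map_of_mem _ ha) ?_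
  rw [IsScalarTower.algebraMap_apply A R (Localization.AtPrime q)]
  exact IsLocalization.map_units (Localization.AtPrime q) (⟨_, haq⟩ : q.primeCompl)

theorem HeightOnePrime.eq_of_le {A : Type*} [CommRing A] {P P' : HeightOnePrime A}
    (h : P.1.asIdeal ≤ P'.1.asIdeal) : P = P' := by
  refine Subtype.ext (PrimeSpectrum.ext ?_)
  have : P.1.asIdeal.FiniteHeight := by simp [Ideal.finiteHeight_iff, P.2]
  exact Ideal.eq_of_le_of_height_le _ h (by rw [P.2, P'.2])

theorem IsDiscreteValuationRing.eq_maximalIdeal_pow_length {S : Type*} [CommRing S] [IsDomain S]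
    [IsDiscreteValuationRing S] {I : Ideal S} (hI : I ≠ ⊥) :
    I = IsLocalRing.maximalIdeal S ^ (Module.length S (S ⧸ I)).toNat := by
  obtain ⟨ϖ, hϖ⟩ := IsDiscreteValuationRing.exists_irreducible S
  obtain ⟨n, rfl⟩ := IsDiscreteValuationRing.ideal_eq_span_pow_irreducible hI hϖ
  have h : Module.length S (S ⧸ Ideal.span {ϖ ^ n}) = n := by
    change Ring.ord S (ϖ ^ n) = n
    rw [Ring.ord_pow (mem_nonZeroDivisors_of_ne_zero hϖ.ne_zero), Ring.ord_of_irreducible hϖ]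
    simp
  rw [h, ENat.toNat_natCast, hϖ.maximalIdeal_eq, Ideal.span_singleton_pow]

theorem WeilDivisor.map_ideal_localRing {A : Type*} [CommRing A] (D : WeilDivisor A) (P : HeightOnePrime A) :
    D.ideal.map (algebraMap A P.localRing) = maximalIdeal P.localRing ^ (D P).toNat := by
  rw [D.map_ideal_eq_pow _ P fun P' hP' => map_eq_top_of_not_le_under fun h =>
    hP' (HeightOnePrime.eq_of_le h), Localization.AtPrime.map_eq_maximalIdeal]

theorem WeilDivisor.map_ideal_localRing_pullback {A : Type u} [CommRing A] [IsDomain A]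
    [IsNoetherianRing A]    {R : Type v} [CommRing R] [IsDomain R]
    [IsNoetherianRing R] [IsIntegrallyClosed R] [Algebra A R] [Module.Flat A R]
    (D : WeilDivisor A) (hD : 0 ≤ D) (Q : HeightOnePrime R) :
    (D.ideal.map (algebraMap A R)).map (algebraMap R Q.localRing) =
      maximalIdeal Q.localRing ^ (D.pullback R Q).toNat := by
  rw [Ideal.map_map, ← IsScalarTower.algebraMap_eq]
  change _ = _ ^ (D.pullbackCoeff R Q).toNat
  rw [pullbackCoeff]
  split_ifs with h
  · set P : HeightOnePrime A := ⟨⟨Q.1.asIdeal.under A, inferInstance⟩, h⟩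
    have hinj : Function.Injective (algebraMap A Q.localRing) := by
      rw [IsScalarTower.algebraMap_eq A R]
      exact (IsLocalization.injective Q.localRing Q.1.asIdeal.primeCompl_le_nonZeroDivisors).comp
        (FaithfulSMul.algebraMap_injective A R)
    rw [D.map_ideal_eq_pow _ P fun P' hP' => map_eq_top_of_not_le_under fun h =>
      hP' (HeightOnePrime.eq_of_le h)]
    have hP : P.1.asIdeal.map (algebraMap A Q.localRing) ≠ ⊥ := by
      rw [Ne, Ideal.map_eq_bot_iff_of_injective hinj]
      exact Ideal.ne_bot_of_height_eq_one h
    rw [Int.toNat_mul (hD P) (Int.natCast_nonneg _), Int.toNat_natCast, mul_comm, pow_mul]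
    exact congrArg (· ^ (D P).toNat) (IsDiscreteValuationRing.eq_maximalIdeal_pow_length hP)
  · rw [Int.toNat_zero, pow_zero, Ideal.one_eq_top]
    -- By going down the contraction of `Q` has height at most one. If it contained a height one
    -- prime, its height would be exactly one, contrary to the case at hand.
    refine D.map_ideal_eq_top _ fun P => map_eq_top_of_not_le_under fun hle => h ?_
    refine le_antisymm ?_ (P.2.symm.le.trans (Ideal.height_mono hle))
    have := Ideal.height_eq_height_add_of_liesOver_of_hasGoingDown (Q.1.asIdeal.under A) Q.1.asIdeal
    exact (le_self_add.trans this.symm.le).trans Q.2.le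

end DivisorIdeal

/-! ### Flat base change of sections -/

section BaseChange

variable {A : Type u} {R : Type v} [CommRing A] [CommRing R] [IsDomain A] [IsDomain R]
  [IsNoetherianRing A] [Algebra A R] [Module.Flat A R]

/-- Flat base change of the module of fractions multiplying a nonzero ideal into the ring. -/
theorem exists_baseChange_equiv {I : Ideal A} (hI : I ≠ ⊥)
    {M : Submodule A (FractionRing A)} {N : Submodule R (FractionRing R)}
    (hM : ∀ z, z ∈ M ↔ ∀ i ∈ I,
      z * algebraMap A (FractionRing A) i ∈ (algebraMap A (FractionRing A)).range)
    (hN : ∀ z, z ∈ N ↔ ∀ i ∈ I, z * algebraMap R (FractionRing R) (algebraMap A R i) ∈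
      (algebraMap R (FractionRing R)).range) (h1 : 1 ∈ M) (h1' : 1 ∈ N) :
    ∃ φ : R ⊗[A] M ≃ₗ[R] N, φ (1 ⊗ₜ ⟨1, h1⟩) = ⟨1, h1'⟩ := by
  obtain ⟨d, hdI, hd0⟩ := Submodule.exists_mem_ne_zero_of_ne_bot hI
  have hinj : Function.Injective (algebraMap A R) := FaithfulSMul.algebraMap_injective A R
  have hinjK : Function.Injective (Algebra.ofId A (FractionRing R)) := by
    have : (Algebra.ofId A (FractionRing R) : A → FractionRing R) =
        algebraMap R (FractionRing R) ∘ algebraMap A R := by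
      ext a; exact IsScalarTower.algebraMap_apply A R (FractionRing R) a
    rw [this]
    exact (IsFractionRing.injective R (FractionRing R)).comp hinj
  let j : FractionRing A →ₐ[A] FractionRing R := IsFractionRing.liftAlgHom hinjK
  have hj : ∀ a, j (algebraMap A _ a) = algebraMap R (FractionRing R) (algebraMap A R a) := by
    intro a
    rw [AlgHom.commutes, IsScalarTower.algebraMap_apply A R (FractionRing R)]
  have hdK : algebraMap A (FractionRing A) d ≠ 0 := by simpa using hd0
  have hdR : algebraMap R (FractionRing R) (algebraMap A R d) ≠ 0 := by
    rw [← hj]; exact (map_ne_zero_iff j j.toRingHom.injective).2 hdK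
  -- With `d` a nonzero element of `I`, the fractions `a / d` with `a ∈ (d) : I` lie in `M`; their
  -- base changes will fill `N`.
  have hfrac : ∀ a ∈ (Ideal.span {d}).colon (I : Set A),
      algebraMap A (FractionRing A) a / algebraMap A _ d ∈ M := by
    intro a ha
    refine (hM _).2 fun i hi => ?_
    obtain ⟨c, hc⟩ := Ideal.mem_span_singleton.1 (Submodule.mem_colon.1 ha i hi)
    refine ⟨c, ?_⟩
    rw [div_mul_eq_mul_div, ← map_mul, ← smul_eq_mul, hc, map_mul, mul_div_cancel_left₀ _ hdK]
  let ψ : R ⊗[A] M →ₗ[R] FractionRing R :=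
    LinearMap.liftBaseChange R (j.toLinearMap ∘ₗ M.subtype)
  have hψ : ∀ r m, ψ (r ⊗ₜ m) = algebraMap R _ r * j m := fun r m => by
    simp [ψ, Algebra.smul_def]
  -- multiplication by `d` embeds `M` into `A`
  choose a ha using fun m : M => (hM m).1 m.2 d hdI
  let μ : M →ₗ[A] A :=
    { toFun := a
      map_add' := fun m m' => IsFractionRing.injective A (FractionRing A) <| by
        rw [map_add, ha, ha, ha, Submodule.coe_add, add_mul]
      map_smul' := fun c m => IsFractionRing.injective A (FractionRing A) <| by
        rw [RingHom.id_apply, smul_eq_mul, map_mul, ha, ha, Submodule.coe_smul, Algebra.smul_def,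
          mul_assoc] }
  have hμ : Function.Injective μ := fun m m' h => Subtype.ext <| mul_right_cancel₀ hdK <| by
    rw [← ha, ← ha]; exact congrArg _ h
  have hψμ : ∀ x, algebraMap R (FractionRing R) (TensorProduct.rid A R (μ.lTensor R x)) =
      ψ x * algebraMap R (FractionRing R) (algebraMap A R d) := by
    intro x
    induction x using TensorProduct.induction_on with
    | zero => simp
    | add x y hx hy => simp only [map_add, hx, hy, add_mul]
    | tmul r m =>
      rw [LinearMap.lTensor_tmul, TensorProduct.rid_tmul, hψ, Algebra.smul_def, map_mul, ← hj,
        show μ m = a m from rfl, ha, map_mul, hj]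
      ring
  have hinjψ : Function.Injective ψ := by
    rw [injective_iff_map_eq_zero]
    intro x hx
    have h := hψμ x
    rw [hx, zero_mul, map_eq_zero_iff _ (IsFractionRing.injective R (FractionRing R)),
      LinearEquiv.map_eq_zero_iff] at h
    exact (map_eq_zero_iff _ (Module.Flat.lTensor_preserves_injective_linearMap μ hμ)).1 h
  have hle : LinearMap.range ψ ≤ N := by
    rintro _ ⟨x, rfl⟩
    induction x using TensorProduct.induction_on with
    | zero => simp
    | add x y hx hy => rw [map_add]; exact N.add_mem hx hy
    | tmul r m =>
      rw [hψ, ← Algebra.smul_def]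
      refine N.smul_mem _ ((hN _).2 fun i hi => ?_)
      obtain ⟨c, hc⟩ := (hM m).1 m.2 i hi
      exact ⟨algebraMap A R c, by rw [← hj, ← hj, hc, map_mul]⟩
  have hge : N ≤ LinearMap.range ψ := by
    intro z hz
    obtain ⟨s, hs⟩ := (hN z).1 hz d hdI
    obtain ⟨n, i, hi⟩ := Submodule.fg_iff_exists_fin_generating_family.1 I.fg_of_isNoetherianRing
    have hiI : ∀ k, i k ∈ I := fun k => hi ▸ Submodule.subset_span ⟨k, rfl⟩
    -- For `z ∈ N` the numerator `s = z d` kills, after base change, the tuple `w` of generators of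
    -- `I` modulo `d`. By flatness `s` lies in the extension of the annihilator of `w`, which is
    -- `(d) : I`.
    let w : Fin n → A ⧸ Ideal.span {d} := fun k => Ideal.Quotient.mk _ (i k)
    have hsw : s ⊗ₜ[A] w = 0 := by
      rw [← (TensorProduct.piRight A A R fun _ : Fin n => A ⧸ Ideal.span {d}).map_eq_zero_iff]
      ext k
      obtain ⟨c, hc⟩ := (hN z).1 hz (i k) (hiI k)
      have hsc : s * algebraMap A R (i k) = c * algebraMap A R d := by
        refine IsFractionRing.injective R (FractionRing R) ?_
        rw [map_mul, map_mul, hs, hc]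
        ring
      calc s ⊗ₜ[A] (w k) = (i k • s) ⊗ₜ[A] (1 : A ⧸ Ideal.span {d}) := by
            rw [TensorProduct.smul_tmul, Algebra.smul_def, mul_one]; rfl
        _ = (d • c) ⊗ₜ[A] (1 : A ⧸ Ideal.span {d}) := by
            rw [Algebra.smul_def, mul_comm, hsc, mul_comm, ← Algebra.smul_def]
        _ = 0 := by
            rw [TensorProduct.smul_tmul, Algebra.smul_def, mul_one, Ideal.Quotient.algebraMap_eq,
              Ideal.Quotient.eq_zero_iff_mem.2 (Ideal.mem_span_singleton_self d),
              TensorProduct.tmul_zero]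
    have hmem := mem_map_torsionOf_of_tmul_eq_zero hsw
    have key : ∀ t ∈ (Ideal.torsionOf A _ w).map (algebraMap A R),
        algebraMap R (FractionRing R) t / algebraMap R _ (algebraMap A R d) ∈
          LinearMap.range ψ := by
      intro t ht
      induction ht using Submodule.span_induction with
      | mem y hy =>
        obtain ⟨b, hb, rfl⟩ := hy
        have hb' : b ∈ (Ideal.span {d}).colon (I : Set A) := by
          refine Submodule.mem_colon.2 fun i' hi' => ?_
          have hi'' : i' ∈ Submodule.span A (Set.range i) := hi ▸ hi'
          induction hi'' using Submodule.span_induction with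
          | mem _ h =>
            obtain ⟨k, rfl⟩ := h
            have h := congrFun ((Ideal.mem_torsionOf_iff _ _).1 hb) k
            rw [Pi.smul_apply, Algebra.smul_def] at h
            exact Ideal.Quotient.eq_zero_iff_mem.1 h
          | zero => simp
          | add x y hx hy h1 h2 =>
            rw [smul_add]; exact add_mem (h1 (hi ▸ hx)) (h2 (hi ▸ hy))
          | smul c x hx h =>
            rw [smul_comm]; exact Submodule.smul_mem _ _ (h (hi ▸ hx))
        exact ⟨1 ⊗ₜ ⟨_, hfrac b hb'⟩, by rw [hψ, map_one, one_mul, map_div₀, hj, hj]⟩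
      | zero => simp
      | add x y _ _ hx hy => rw [map_add, add_div]; exact add_mem hx hy
      | smul c y _ hy =>
        rw [smul_eq_mul, map_mul, mul_div_assoc, ← Algebra.smul_def]
        exact Submodule.smul_mem _ _ hy
    have := key s hmem
    rwa [hs, mul_div_cancel_right₀ _ hdR] at this
  refine ⟨(LinearEquiv.ofInjective ψ hinjψ).trans (LinearEquiv.ofEq _ _ (le_antisymm hle hge)),
    Subtype.ext ?_⟩
  change ψ (1 ⊗ₜ ⟨1, h1⟩) = 1
  rw [hψ, map_one, map_one, one_mul]

/-- The modules of sections of an effective Weil divisor commute with flat base change. -/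
theorem WeilDivisor.exists_baseChange_sections_equiv [IsIntegrallyClosed A] [IsNoetherianRing R]
    [IsIntegrallyClosed R] (D : WeilDivisor A) (hD : 0 ≤ D) :
    ∃ φ : R ⊗[A] D.sections ≃ₗ[R] (D.pullback R).sections,
      φ (1 ⊗ₜ ⟨algebraMap A (FractionRing A) 1, algebraMap_mem_sections hD 1⟩) =
        ⟨algebraMap R (FractionRing R) 1,
          algebraMap_mem_sections (pullback_nonneg R hD) 1⟩ := by
  simp only [map_one]
  refine exists_baseChange_equiv D.ideal_ne_bot (mem_sections_iff hD D.map_ideal_localRing)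
    (fun z => ?_) _ _
  rw [mem_sections_iff (pullback_nonneg R hD) (D.map_ideal_localRing_pullback hD)]
  refine ⟨fun h i hi => h _ (Ideal.mem_map_of_mem _ hi), fun h i hi => ?_⟩
  induction hi using Submodule.span_induction with
  | mem y hy =>
    obtain ⟨i, hi, rfl⟩ := hy
    exact h i hi
  | zero => simp
  | add x y _ _ hx hy => rw [map_add, mul_add]; exact add_mem hx hy
  | smul c x _ hx =>
    rw [smul_eq_mul, map_mul, mul_left_comm]
    exact mul_mem ⟨c, rfl⟩ hx

end BaseChange

/-! ### Degeneracy ideals as impurity ideals over `F^e_* A` -/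

section FrobeniusRing

theorem impurityIdeal_map_equiv {A : Type u} {B : Type*} [CommRing A] [CommRing B] [Algebra A B]
    {M M' : Type*} [AddCommGroup M] [Module A M] [Module B M] [IsScalarTower A B M]
    [AddCommGroup M'] [Module A M'] [Module B M'] [IsScalarTower A B M'] (φ : M ≃ₗ[B] M') (n : M) :
    impurityIdeal A B (φ n) = impurityIdeal A B n := by
  have h : ∀ b : B, IsPureMap (LinearMap.toSpanSingleton A M' (b • φ n)) ↔
      IsPureMap (LinearMap.toSpanSingleton A M (b • n)) := by
    intro b
    have hcomp : LinearMap.toSpanSingleton A M' (b • φ n) =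
        (φ.restrictScalars A).toLinearMap ∘ₗ LinearMap.toSpanSingleton A M (b • n) := by
      ext
      simp
    refine forall_congr' fun Q => forall_congr' fun _ => forall_congr' fun _ => ?_
    rw [hcomp, LinearMap.rTensor_comp, LinearMap.coe_comp]
    exact ((φ.restrictScalars A).rTensor Q).injective.of_comp_iff _
  simp only [impurityIdeal, h]

/-- The ring `F^e_* R`: a copy of `R`, an algebra over `R` through the `e`-th Frobenius power. -/
def FrobeniusRing (R : Type*) (_p _e : ℕ) : Type _ := R

namespace FrobeniusRing

variable (A R : Type*) (p e : ℕ) [CommRing A] [CommRing R] [Algebra A R]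

instance : CommRing (FrobeniusRing R p e) := inferInstanceAs (CommRing R)

instance [IsNoetherianRing R] : IsNoetherianRing (FrobeniusRing R p e) :=
  inferInstanceAs (IsNoetherianRing R)

instance [ExpChar R p] : Algebra A (FrobeniusRing R p e) :=
  RingHom.toAlgebra (S := R) ((iterateFrobenius R p e).comp (algebraMap A R))

instance : Algebra (FrobeniusRing A p e) (FrobeniusRing R p e) := inferInstanceAs (Algebra A R)

instance [ExpChar R p] : IsScalarTower A R (FrobeniusRing R p e) :=
  .of_algebraMap_eq' (R := A) (S := R) (A := FrobeniusRing R p e) rfl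

instance [ExpChar A p] [ExpChar R p] : IsScalarTower A (FrobeniusRing A p e) (FrobeniusRing R p e) :=
  .of_algebraMap_eq (R := A) (S := FrobeniusRing A p e) (A := FrobeniusRing R p e) fun a =>
    ((algebraMap A R).map_iterateFrobenius p a e).symm

instance (M : Type*) [AddCommGroup M] [Module R M] :
    Module (FrobeniusRing R p e) (FrobeniusPushforward R p e M) := inferInstanceAs (Module R M)

instance [ExpChar R p] (M : Type*) [AddCommGroup M] [Module R M] :
    IsScalarTower R (FrobeniusRing R p e) (FrobeniusPushforward R p e M) :=
  ⟨fun _ _ _ => mul_smul (α := R) (β := M) _ _ _⟩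

end FrobeniusRing

variable {A : Type u} [CommRing A] [IsDomain A] [IsNoetherianRing A] [IsIntegrallyClosed A]

/-- The section `F^e_* 1` of `F^e_* A(D)`. -/
def WeilDivisor.frobeniusOne (D : WeilDivisor A) (p e : ℕ) (hD : 0 ≤ D) :
    FrobeniusPushforward A p e D.sections :=
  FrobeniusPushforward.of A p e D.sections
    ⟨algebraMap A (FractionRing A) 1, algebraMap_mem_sections hD 1⟩

theorem WeilDivisor.degeneracyIdeal_eq (D : WeilDivisor A) (p e : ℕ) [ExpChar A p] (hD : 0 ≤ D) :
    D.degeneracyIdeal p e hD = impurityIdeal A (FrobeniusRing A p e) (D.frobeniusOne p e hD) := by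
  refine congrArg Ideal.span (Set.ext fun a => not_congr ?_)
  have h : D.frobeniusMap p e hD a = LinearMap.toSpanSingleton A _
      ((show FrobeniusRing A p e from a) • D.frobeniusOne p e hD) := by
    refine congrArg (LinearMap.toSpanSingleton A (FrobeniusPushforward A p e D.sections)) ?_
    refine Subtype.ext ?_
    change algebraMap A (FractionRing A) a = a • algebraMap A (FractionRing A) 1
    rw [Algebra.smul_def, map_one, mul_one]
  rw [h]

theorem WeilDivisor.degeneracyIdeal_pullback_eq {R : Type v} [CommRing R] [IsDomain R]
    [IsNoetherianRing R] [IsIntegrallyClosed R] [Algebra A R] [Module.Flat A R]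
    (D : WeilDivisor A) (p e : ℕ) [ExpChar A p] [ExpChar R p] (hD : 0 ≤ D) :
    (D.pullback R).degeneracyIdeal p e (pullback_nonneg R hD) =
      impurityIdeal R (FrobeniusRing R p e)
        ((1 : FrobeniusRing R p e) ⊗ₜ[FrobeniusRing A p e] D.frobeniusOne p e hD) := by
  obtain ⟨φ, hφ⟩ := D.exists_baseChange_sections_equiv (R := R) hD
  -- Restriction along Frobenius does not enter the tensor product over `F^e_* A`, which is by
  -- definition `R ⊗[A] A(D)`, so `φ` serves unchanged.
  let ψ : FrobeniusRing R p e ⊗[FrobeniusRing A p e] FrobeniusPushforward A p e D.sections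
      ≃ₗ[FrobeniusRing R p e] FrobeniusPushforward R p e (D.pullback R).sections := φ
  rw [degeneracyIdeal_eq]
  have h : ψ (1 ⊗ₜ D.frobeniusOne p e hD) =
    (D.pullback R).frobeniusOne p e (pullback_nonneg R hD) := hφ
  rw [← h]
  exact impurityIdeal_map_equiv (A := R) ψ _

end FrobeniusRing

/-! ### Base change of degeneracy ideals -/

section FrobeniusBaseChange

open RingTheory.Sequence

theorem mk_mem_smul_top_iff {R : Type*} [CommRing R] (J K : Ideal R) (b : R) :
    Ideal.Quotient.mk K b ∈ (J • ⊤ : Submodule R (R ⧸ K)) ↔ b ∈ K ⊔ J := by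
  have h : (J • ⊤ : Submodule R (R ⧸ K)) = Submodule.map K.mkQ J := by
    rw [← Submodule.range_mkQ K, LinearMap.range_eq_map, ← Submodule.map_smul'', smul_eq_mul,
      Ideal.mul_top]
  rw [h, ← Submodule.comap_map_mkQ]
  rfl

theorem map_ofList {R S : Type*} [CommRing R] [CommRing S] (φ : R →+* S) (l : List R) :
    (Ideal.ofList l).map φ = Ideal.ofList (l.map φ) := by
  rw [Ideal.ofList, Ideal.map_span, Ideal.ofList]
  congr 1
  ext y
  simp

theorem map_pow_map_pow {R : Type*} [Monoid R] (l : List R) (s t : ℕ) :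
    (l.map (· ^ s)).map (· ^ t) = l.map (· ^ (s * t)) := by
  simp [Function.comp_def, pow_mul]

variable {A : Type u} {R : Type v} [CommRing A] [CommRing R] [Algebra A R]
  [IsLocalRing A] [IsNoetherianRing A] [IsLocalRing R] [IsNoetherianRing R]
  [IsLocalHom (algebraMap A R)] [Module.Flat A R]

theorem isWeaklyRegular_quotient_map {l : List R}
    (hreg : IsWeaklyRegular (R ⊗[A] (A ⧸ maximalIdeal A)) l) (I : Ideal A) :
    IsWeaklyRegular (R ⧸ I.map (algebraMap A R)) l :=
  (I.qoutMapEquivTensorQout R).isWeaklyRegular_congr l |>.2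
    ((isWeaklyRegular_tensor_and_flat.{u} l hreg).1 _)

/-- The colon identity for the sequence `x_i ^ (s + 1)` on `R ⧸ IR`, where it is regular because it
is so on the closed fibre. It is used with `s + 1 = p ^ e`. -/
theorem mem_sup_ofList_of_mul_prod_pow_mem {l : List R} (hl : ∀ y ∈ l, y ∈ maximalIdeal R)
    (hreg : IsWeaklyRegular (R ⊗[A] (A ⧸ maximalIdeal A)) l) (I : Ideal A) (s t : ℕ) {b : R}
    (hb : b * (l.prod ^ t) ^ (s + 1) ∈ I.map (algebraMap A R) ⊔
      Ideal.ofList (l.map (· ^ ((s + 1) * (t + 1))))) :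
    b ∈ I.map (algebraMap A R) ⊔ Ideal.ofList (l.map (· ^ (s + 1))) := by
  have h1 := isWeaklyRegular_pow_append s l [] (by simpa using hl)
    (by simpa using isWeaklyRegular_quotient_map hreg I)
  rw [List.append_nil] at h1
  have hl' : ∀ y ∈ l.map (· ^ (s + 1)), y ∈ maximalIdeal R := by
    intro y hy
    obtain ⟨x, hx, rfl⟩ := List.mem_map.1 hy
    exact Ideal.pow_mem_of_mem _ (hl x hx) _ s.succ_pos
  have h2 := mem_of_prod_pow_smul_mem t (u := Ideal.Quotient.mk (I.map (algebraMap A R)) b)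
    (l.map (· ^ (s + 1))) [] (by simpa using hl') (by simpa using h1)
  rw [List.append_nil, List.append_nil, mk_mem_smul_top_iff] at h2
  refine h2 ?_
  rw [Algebra.smul_def, Ideal.Quotient.algebraMap_eq, ← map_mul, mk_mem_smul_top_iff, mul_comm]
  have hprod : (l.map (· ^ (s + 1))).prod = l.prod ^ (s + 1) :=
    (map_list_prod (powMonoidHom (s + 1)) l).symm
  rwa [map_pow_map_pow, hprod, pow_right_comm]

/-- The degeneracy ideal of `F^e_* M` under a flat local base change with regular closed fibre. -/
theorem impurityIdeal_frobenius_baseChange (p e : ℕ) [ExpChar A p] [ExpChar R p] (hp : 0 < p)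
    {M : Type*} [AddCommGroup M] [Module A M]
    (n : FrobeniusPushforward A p e M) (l : List R) (hl : ∀ y ∈ l, y ∈ maximalIdeal R)
    (hreg : IsWeaklyRegular (R ⊗[A] (A ⧸ maximalIdeal A)) l)
    (hmax : (maximalIdeal A).map (algebraMap A R) ⊔ Ideal.ofList l = maximalIdeal R) :
    impurityIdeal R (FrobeniusRing R p e) ((1 : FrobeniusRing R p e) ⊗ₜ[FrobeniusRing A p e] n) =
      (impurityIdeal A (FrobeniusRing A p e) n).map
        (algebraMap (FrobeniusRing A p e) (FrobeniusRing R p e)) ⊔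
      (Ideal.ofList l).map (algebraMap R (FrobeniusRing R p e)) := by
  obtain ⟨s, hs⟩ : ∃ s, p ^ e = s + 1 := Nat.exists_eq_add_one.2 (pow_pos hp e)
  have hmap : ∀ l : List R, (Ideal.ofList l).map (iterateFrobenius R p e) =
      Ideal.ofList (l.map (· ^ (s + 1))) := by
    intro l
    rw [map_ofList]
    congr 2
    ext y
    rw [iterateFrobenius_def, hs]
  refine impurityIdeal_baseChange n l hl hreg hmax (fun t => ?_) (fun I t b hb => ?_)
  -- Frobenius turns the exponents `t + 1` into `(t + 1) (s + 1)`; flatness over `F^e_* A` of a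
  -- quotient of `F^e_* R` is by definition flatness over `A` of the same quotient of `R`.
  · have h := flat_quotient_ofList_pow hl hreg ((t + 1) * (s + 1) - 1)
    rw [Nat.sub_add_cancel (Nat.mul_pos t.succ_pos s.succ_pos)] at h
    have h' : Module.Flat A
        (R ⧸ (Ideal.ofList (l.map (· ^ (t + 1)))).map (iterateFrobenius R p e)) := by
      rw [hmap, map_pow_map_pow]
      exact h
    exact h'
  · have key : ∀ b : R, b * iterateFrobenius R p e (l.prod ^ t) ∈ Ideal.map (algebraMap A R) I ⊔
        (Ideal.ofList (l.map (· ^ (t + 1)))).map (iterateFrobenius R p e) →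
        b ∈ Ideal.map (algebraMap A R) I ⊔ (Ideal.ofList l).map (iterateFrobenius R p e) := by
      intro b hb
      rw [hmap, map_pow_map_pow, iterateFrobenius_def, hs, mul_comm (t + 1)] at hb
      rw [hmap]
      exact mem_sup_ofList_of_mul_prod_pow_mem hl hreg I s t hb
    exact key b hb

end FrobeniusBaseChange

/-! ### Lengths when the closed fibre is the residue field -/

section LengthFibre

variable {A : Type u} {R : Type v} [CommRing A] [CommRing R] [Algebra A R] [IsLocalRing A]

/-- By flatness lengths add along a composition series of `Q`, and each simple factor contributes
the length of the closed fibre, which is one. -/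
theorem length_tensor_eq {S : Type*} [AddCommGroup S] [Module R S] [Module A S]
    [IsScalarTower A R S] [Module.Flat A S]
    (hS : Module.length R (S ⊗[A] (A ⧸ maximalIdeal A)) = 1) {Q : Type w} [AddCommGroup Q]
    [Module A Q] (hQ : IsFiniteLength A Q) :
    Module.length R (S ⊗[A] Q) = Module.length A Q := by
  induction hQ with
  | of_subsingleton => simp [Module.length_eq_zero]
  | @of_simple_quotient Q _ _ N hsimp hN ih =>
    have h1 : Module.length A Q = Module.length A N + Module.length A (Q ⧸ N) :=
      Module.length_eq_add_of_exact N.subtype N.mkQ N.injective_subtype N.mkQ_surjective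
        (LinearMap.exact_subtype_mkQ N)
    have h2 : Module.length R (S ⊗[A] Q) =
        Module.length R (S ⊗[A] N) + Module.length R (S ⊗[A] (Q ⧸ N)) :=
      Module.length_eq_add_of_exact (AlgebraTensorModule.lTensor R S N.subtype)
        (AlgebraTensorModule.lTensor R S N.mkQ)
        (Module.Flat.lTensor_preserves_injective_linearMap _ N.injective_subtype)
        (LinearMap.lTensor_surjective _ N.mkQ_surjective)
        (lTensor_exact S (LinearMap.exact_subtype_mkQ N) N.mkQ_surjective)
    obtain ⟨I, hI, ⟨f⟩⟩ := isSimpleModule_iff_quot_maximal.1 hsimp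
    obtain rfl := eq_maximalIdeal hI
    rw [h1, h2, ih, Module.length_eq_one A (Q ⧸ N), ← hS,
      (AlgebraTensorModule.congr (LinearEquiv.refl R S) f).length_eq]

theorem length_quotient_map_sup [IsLocalRing R] {J : Ideal R} [Module.Flat A (R ⧸ J)]
    (hJ : (maximalIdeal A).map (algebraMap A R) ⊔ J = maximalIdeal R) {I : Ideal A}
    (hI : IsFiniteLength A (A ⧸ I)) :
    Module.length R (R ⧸ (I.map (algebraMap A R) ⊔ J)) = Module.length A (A ⧸ I) := by
  have key : ∀ K : Ideal A, Module.length R ((R ⧸ J) ⊗[A] (A ⧸ K)) =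
      Module.length R (R ⧸ (K.map (algebraMap A R) ⊔ J)) := by
    intro K
    have h : K.map (algebraMap A (R ⧸ J)) =
        (K.map (algebraMap A R)).map (Ideal.Quotient.mkₐ R J) := by
      rw [IsScalarTower.algebraMap_eq A R (R ⧸ J), ← Ideal.map_map]
      rfl
    rw [← ((K.qoutMapEquivTensorQout (R ⧸ J)).restrictScalars R).length_eq, h, sup_comm]
    exact (DoubleQuot.quotQuotEquivQuotSupₐ R J (K.map (algebraMap A R))).toLinearEquiv.length_eq
  rw [← key]
  refine length_tensor_eq ?_ hI
  rw [key, hJ]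
  have : IsSimpleModule R (R ⧸ maximalIdeal R) :=
    isSimpleModule_iff_quot_maximal.2 ⟨_, inferInstance, ⟨LinearEquiv.refl R _⟩⟩
  exact Module.length_eq_one R _

end LengthFibre

/-! ### The theorem for a list of parameters -/

section Main

open RingTheory.Sequence

theorem sup_ofList_eq_maximalIdeal {R : Type*} [CommRing R] [IsLocalRing R] {I : Ideal R}
    [IsLocalRing (R ⧸ I)] {l : List R}
    (h : Ideal.ofList (l.map (Ideal.Quotient.mk I)) = maximalIdeal (R ⧸ I)) :
    I ⊔ Ideal.ofList l = maximalIdeal R := by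
  have hloc : IsLocalHom (Ideal.Quotient.mk I) := .of_surjective _ Ideal.Quotient.mk_surjective
  rw [← map_ofList] at h
  have h2 := congrArg (Ideal.comap (Ideal.Quotient.mk I)) h
  rw [Ideal.comap_map_of_surjective _ Ideal.Quotient.mk_surjective, ← RingHom.ker_eq_comap_bot,
    Ideal.mk_ker, sup_comm] at h2
  rw [h2]
  exact ((local_hom_TFAE (Ideal.Quotient.mk I)).out 0 4).1 hloc

variable {A : Type u} {R : Type v} [CommRing A] [CommRing R] [Algebra A R]
  [IsLocalRing A] [IsNoetherianRing R]

theorem isWeaklyRegular_fibre [IsLocalRing (R ⧸ (maximalIdeal A).map (algebraMap A R))]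
    {l : List R}
    (hdim : ringKrullDim (R ⧸ (maximalIdeal A).map (algebraMap A R)) = l.length)
    (h : Ideal.ofList (l.map (Ideal.Quotient.mk ((maximalIdeal A).map (algebraMap A R)))) =
      maximalIdeal (R ⧸ (maximalIdeal A).map (algebraMap A R))) :
    IsWeaklyRegular (R ⊗[A] (A ⧸ maximalIdeal A)) l := by
  have h1 := isWeaklyRegular_of_ofList_eq_maximalIdeal l.length _ (List.length_map _) h hdim
  rw [← Ideal.Quotient.algebraMap_eq, isWeaklyRegular_map_algebraMap_iff] at h1
  exact ((maximalIdeal A).qoutMapEquivTensorQout R).isWeaklyRegular_congr l |>.1 h1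

variable [IsNoetherianRing A] [IsLocalRing R] [IsLocalHom (algebraMap A R)]

theorem ringKrullDim_eq_add_fibre [Module.Flat A R]
    [IsLocalRing (R ⧸ (maximalIdeal A).map (algebraMap A R))] :
    ringKrullDim R =
      ringKrullDim A + ringKrullDim (R ⧸ (maximalIdeal A).map (algebraMap A R)) := by
  have h := Ideal.height_eq_height_add_of_liesOver_of_hasGoingDown (maximalIdeal A) (maximalIdeal R)
  rw [← maximalIdeal_height_eq_ringKrullDim, h, ← maximalIdeal_height_eq_ringKrullDim,
    ← maximalIdeal_height_eq_ringKrullDim, WithBot.coe_add,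
    map_maximalIdeal_of_surjective _ Ideal.Quotient.mk_surjective]

theorem exists_list_ofList_eq_maximalIdeal (S : Type*) [CommRing S] [IsRegularLocalRing S] :
    ∃ l : List S, ringKrullDim S = l.length ∧ Ideal.ofList l = maximalIdeal S := by
  obtain ⟨s, hs, hspan⟩ :=
    Submodule.FG.exists_span_finset_card_eq_spanFinrank (maximalIdeal S).fg_of_isNoetherianRing
  refine ⟨s.toList, ?_, ?_⟩
  · rw [Finset.length_toList, hs]
    exact ((isRegularLocalRing_iff S).1 inferInstance).symm
  · rw [← hspan, Ideal.ofList]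
    congr 1
    ext
    simp

variable [IsDomain A] [IsIntegrallyClosed A] [IsDomain R] [IsIntegrallyClosed R] [Module.Flat A R]

theorem WeilDivisor.isFiniteLength_quotient_degeneracyIdeal (D : WeilDivisor A) (hD : 0 ≤ D)
    (p e : ℕ) [ExpChar A p] : IsFiniteLength A (A ⧸ D.degeneracyIdeal p e hD) := by
  have hle : maximalIdeal A ≤ (D.degeneracyIdeal p e hD).radical := fun a ha => by
    refine ⟨p ^ e, ?_⟩
    rw [D.degeneracyIdeal_eq]
    exact map_maximalIdeal_le_impurityIdeal (B := FrobeniusRing A p e) (D.frobeniusOne p e hD)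
      (Ideal.mem_map_of_mem (algebraMap A (FrobeniusRing A p e)) ha)
  obtain ⟨j, hj⟩ := Ideal.exists_pow_le_of_le_radical_of_fg hle
    (maximalIdeal A).fg_of_isNoetherianRing
  exact isFiniteLength_quotient_of_pow_le hj

theorem WeilDivisor.degeneracyIdeal_pullback_eq_sup
    [IsLocalRing (R ⧸ (maximalIdeal A).map (algebraMap A R))]
    (D : WeilDivisor A) (hD : 0 ≤ D) (p e : ℕ) [ExpChar A p] [ExpChar R p] (hp : 0 < p)
    {l : List R} (hdim : ringKrullDim (R ⧸ (maximalIdeal A).map (algebraMap A R)) = l.length)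
    (hl : Ideal.ofList (l.map (Ideal.Quotient.mk ((maximalIdeal A).map (algebraMap A R)))) =
      maximalIdeal (R ⧸ (maximalIdeal A).map (algebraMap A R))) :
    (D.pullback R).degeneracyIdeal p e (pullback_nonneg R hD) =
      (D.degeneracyIdeal p e hD).map (algebraMap A R) ⊔ Ideal.ofList (l.map (· ^ p ^ e)) := by
  have hmax := sup_ofList_eq_maximalIdeal hl
  have hlmem : ∀ y ∈ l, y ∈ maximalIdeal R := fun y hy =>
    hmax ▸ Ideal.mem_sup_right (Ideal.subset_span hy)
  have h := impurityIdeal_frobenius_baseChange p e hp (D.frobeniusOne p e hD) l hlmem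
    (isWeaklyRegular_fibre hdim hl) hmax
  have hmap : (Ideal.ofList l).map (iterateFrobenius R p e) = Ideal.ofList (l.map (· ^ p ^ e)) := by
    rw [map_ofList]
    rfl
  rw [← hmap, D.degeneracyIdeal_eq, D.degeneracyIdeal_pullback_eq]
  exact h

theorem WeilDivisor.length_quotient_degeneracyIdeal_pullback
    [IsLocalRing (R ⧸ (maximalIdeal A).map (algebraMap A R))]
    (D : WeilDivisor A) (hD : 0 ≤ D) (p e : ℕ) [ExpChar A p] [ExpChar R p] (hp : 0 < p)
    {l : List R} (hdim : ringKrullDim (R ⧸ (maximalIdeal A).map (algebraMap A R)) = l.length)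
    (hl : Ideal.ofList (l.map (Ideal.Quotient.mk ((maximalIdeal A).map (algebraMap A R)))) =
      maximalIdeal (R ⧸ (maximalIdeal A).map (algebraMap A R))) :
    Module.length R (R ⧸ (D.pullback R).degeneracyIdeal p e (pullback_nonneg R hD)) =
      (p ^ (e * l.length) : ℕ) * Module.length A (A ⧸ D.degeneracyIdeal p e hD) := by
  obtain ⟨s, hs⟩ : ∃ s, p ^ e = s + 1 := Nat.exists_eq_add_one.2 (pow_pos hp e)
  have hmax := sup_ofList_eq_maximalIdeal hl
  have hlmem : ∀ y ∈ l, y ∈ maximalIdeal R := fun y hy =>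
    hmax ▸ Ideal.mem_sup_right (Ideal.subset_span hy)
  have hreg := isWeaklyRegular_fibre hdim hl
  have hflat : Module.Flat A (R ⧸ Ideal.ofList l) := by
    have h := flat_quotient_ofList_pow hlmem hreg 0
    rwa [show l.map (· ^ (0 + 1)) = l by simp] at h
  set I := D.degeneracyIdeal p e hD
  -- Each of the `l.length` parameters, regular on `R ⧸ IR`, contributes a factor `s + 1 = p ^ e`;
  -- what remains is the colength of `IR + (l)`, which equals that of `I` in `A`.
  have hlen := length_quotient_pow_append (C := R ⧸ I.map (algebraMap A R)) s l []
    (by simpa using hlmem) (by simpa using isWeaklyRegular_quotient_map hreg I)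
  have hquot : ∀ J : Ideal R,
      Module.length R ((R ⧸ I.map (algebraMap A R)) ⧸ 
        (J • ⊤ : Submodule R (R ⧸ I.map (algebraMap A R)))) =
        Module.length R (R ⧸ (I.map (algebraMap A R) ⊔ J)) := by
    intro J
    rw [← Submodule.range_mkQ (I.map (algebraMap A R)), LinearMap.range_eq_map,
      ← Submodule.map_smul'', smul_eq_mul, Ideal.mul_top]
    exact (Submodule.quotientQuotientEquivQuotientSup (I.map (algebraMap A R)) J).length_eq
  rw [List.append_nil, List.append_nil, hquot, hquot,
    length_quotient_map_sup hmax (D.isFiniteLength_quotient_degeneracyIdeal hD p e)] at hlen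
  rw [D.degeneracyIdeal_pullback_eq_sup hD p e hp hdim hl, hs, hlen, pow_mul, hs]

end Main

end

theorem lemma3p4 {A R : Type*} [CommRing A] [CommRing R]
    [IsNoetherianRing A] [IsLocalRing A] [IsDomain A] [IsIntegrallyClosed A]
    [IsNoetherianRing R] [IsLocalRing R] [IsDomain R] [IsIntegrallyClosed R]
    (p : ℕ) [Fact p.Prime] [CharP A p] [CharP R p]
    [Algebra A R] [Module.Flat A R] [IsLocalHom (algebraMap A R)]
    [IsRegularLocalRing (R ⧸ (maximalIdeal A).map (algebraMap A R))]
    (D : WeilDivisor A) (hD : 0 ≤ D) (e : ℕ) (he : 0 < e) :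
    (∃ n : ℕ, ringKrullDim R = ringKrullDim A + n ∧
      Module.length A (A ⧸ D.degeneracyIdeal p e hD) ≠ ⊤ ∧
      Module.length R (R ⧸ (D.pullback R).degeneracyIdeal p e (WeilDivisor.pullback_nonneg R hD)) =
        (p ^ (e * n) : ℕ) * Module.length A (A ⧸ D.degeneracyIdeal p e hD)) ∧
    ∀ (δ : ℕ) (x : Fin δ → R),
      ringKrullDim (R ⧸ (maximalIdeal A).map (algebraMap A R)) = δ →
      Ideal.span (Set.range fun i =>
          Ideal.Quotient.mk ((maximalIdeal A).map (algebraMap A R)) (x i)) =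
        maximalIdeal (R ⧸ (maximalIdeal A).map (algebraMap A R)) →
      (D.pullback R).degeneracyIdeal p e (WeilDivisor.pullback_nonneg R hD) =
        (D.degeneracyIdeal p e hD).map (algebraMap A R) ⊔
          Ideal.span (Set.range fun i => x i ^ p ^ e) := by
  have hp : 0 < p := (Fact.out : p.Prime).pos
  refine ⟨?_, fun δ x hdim hx => ?_⟩
  · obtain ⟨l', hdim, hl'⟩ :=
      exists_list_ofList_eq_maximalIdeal (R ⧸ (maximalIdeal A).map (algebraMap A R))
    obtain ⟨l, rfl⟩ := List.map_surjective_iff.2 Ideal.Quotient.mk_surjective l'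
    rw [List.length_map] at hdim
    refine ⟨l.length, ?_, ?_, D.length_quotient_degeneracyIdeal_pullback hD p e hp hdim hl'⟩
    · rw [← hdim]
      exact ringKrullDim_eq_add_fibre
    · exact Module.length_ne_top_iff.2 (D.isFiniteLength_quotient_degeneracyIdeal hD p e)
  · have hofFn : ∀ {S : Type _} [CommRing S] (f : Fin δ → S),
        Ideal.ofList (List.ofFn f) = Ideal.span (Set.range f) := fun f => by
      simp [Ideal.ofList, Set.range, List.mem_ofFn]
    rw [D.degeneracyIdeal_pullback_eq_sup hD p e hp (l := List.ofFn x) (by simpa using hdim) (by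
      rw [List.map_ofFn, hofFn]
      exact hx), List.map_ofFn, hofFn]
    rfl
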